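/- Let $\mathbb{L}^4$ be $\mathbb{R}^4$ with the Lorentzian metric $\langle x,y\rangle=-x_0y_0+x_1y_1+x_2y_2+x_3y_3$. Let $\Sigma$ be a connected smooth surface and $\psi:\Sigma\to\mathbb{L}^4$ a spacelike immersion, i.e. a smooth map whose induced metric $g=\langle d\psi,d\psi\rangle$ is Riemannian. Let $\mathbf{H}=\tfrac12\operatorname{tr}_g \mathrm{II}$ be its mean curvature vector, where $\mathrm{II}$ is the second fundamental form with values in the normal bundle. Suppose that $\mathbf{H}$ is parallel in the normal bundle, $\nabla^{\perp}\mathbf{H}\equiv 0$, and that $\psi$ is not maximal, i.e. $\mathbf{H}$ does not vanish identically. Then $\psi(\Sigma)$ is contained in a totally umbilical affine hyperquadric $\mathbb{Q}^3$ of $\mathbb{L}^4$, namely in an affine hyperplane $\{x:\langle n,x\rangle=c\}$ with $n\neq 0$, $c\in\mathbb{R}$, or in a hyperquadric $\{x\neq a:\langle x-a,x-a\rangle=\rho\}$ with $a\in\mathbb{L}^4$, $\rho\in\mathbb{R}$. (Degenerate hyperplanes, and light cones $\rho=0$, are included. The hyperquadrics with nondegenerate induced metric are the spacelike and timelike affine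 hyperplanes, isometric to $\mathbb{R}^3$ and $\mathbb{L}^3$, and the translates of the de Sitter spaces $\mathbb{S}^3_1(r^2)$ and of the two-sheeted hyperbolic spaces $\pm\mathbb{H}^3(-r^2)$.) Moreover, $\mathbb{Q}^3$ can be chosen so that, if its induced metric is nondegenerate, $\psi$ is a surface of constant mean curvature in this three-dimensional space form: $|\langle\mathbf{H},\nu\rangle|$ takes the same value at all points of $\Sigma$, where $\nu$ is a unit normal vector of $\psi$ tangent to $\mathbb{Q}^3$. -/

import Mathlib

open scoped Manifold ContDiff

noncomputable section

namespace Minkowski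

/-- The vector space underlying the Lorentz-Minkowski space, with coordinates
`(x₀, x₁, x₂, x₃)`. -/
abbrev L4 : Type := Fin 4 → ℝ

/-- The model plane of surfaces. -/
abbrev Plane : Type := EuclideanSpace ℝ (Fin 2)

/-- The Lorentzian product `-x₀y₀ + x₁y₁ + x₂y₂ + x₃y₃`. -/
def lor (x y : L4) : ℝ := -(x 0 * y 0) + x 1 * y 1 + x 2 * y 2 + x 3 * y 3

section Surface

variable {S : Type*} [TopologicalSpace S] [ChartedSpace Plane S]

/-- The differential of `f` at `x`, applied to the tangent vector with coordinates `v` in the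
preferred chart at `x` (which identifies `TangentSpace (𝓡 2) x` with the plane). -/
def diff (f : S → L4) (x : S) (v : Plane) : L4 :=
  mfderiv (𝓡 2) 𝓘(ℝ, L4) f x v

/-- A smooth map whose induced metric `(v, w) ↦ ⟨dψ v, dψ w⟩` is Riemannian; in particular, it is
an immersion. -/
structure IsSpacelike (ψ : S → L4) : Prop where
  smooth : ContMDiff (𝓡 2) 𝓘(ℝ, L4) ∞ ψ
  pos : ∀ (x : S) (v : Plane), v ≠ 0 → 0 < lor (diff ψ x v) (diff ψ x v)

/-- The coordinate tangent vectors. -/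
def coordVec (i : Fin 2) : Plane := EuclideanSpace.single i 1

/-- The matrix `gᵢⱼ` of the induced metric at `x` in the preferred chart at `x`. -/
def gram (ψ : S → L4) (x : S) : Matrix (Fin 2) (Fin 2) ℝ :=
  Matrix.of fun i j => lor (diff ψ x (coordVec i)) (diff ψ x (coordVec j))

/-- The component `w^⊥ = w - ∑ gⁱʲ ⟨w, ∂ⱼψ⟩ ∂ᵢψ` of `w` normal to the surface at `x`. -/
def normalPart (ψ : S → L4) (x : S) (w : L4) : L4 :=
  w - ∑ i, ∑ j, ((gram ψ x)⁻¹ i j * lor w (diff ψ x (coordVec j))) • diff ψ x (coordVec i)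

/-- The second derivative of `ψ` at `x`, read in the preferred chart at `x`. -/
def hessian (ψ : S → L4) (x : S) (v w : Plane) : L4 :=
  fderiv ℝ (fderiv ℝ (ψ ∘ (chartAt Plane x).symm)) (chartAt Plane x x) v w

/-- The second fundamental form `II(v, w)`, the normal part of the second derivative (it does not
depend on the chart). -/
def secondForm (ψ : S → L4) (x : S) (v w : Plane) : L4 :=
  normalPart ψ x (hessian ψ x v w)

/-- The mean curvature vector `H = ½ tr_g II = ½ ∑ gⁱʲ II(∂ᵢ, ∂ⱼ)`. -/
def meanCurv (ψ : S → L4) (x : S) : L4 :=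
  (1 / 2 : ℝ) • ∑ i, ∑ j, (gram ψ x)⁻¹ i j • secondForm ψ x (coordVec i) (coordVec j)

/-- The normal connection `∇^⊥_v ξ`, the normal part of the derivative of the normal field `ξ`. -/
def normalConn (ψ ξ : S → L4) (x : S) (v : Plane) : L4 :=
  normalPart ψ x (diff ξ x v)

/-- The mean curvature vector is parallel in the normal bundle, `∇^⊥ H ≡ 0`. -/
def HasParallelMeanCurv (ψ : S → L4) : Prop :=
  ∀ (x : S) (v : Plane), normalConn ψ (meanCurv ψ) x v = 0

/-- The mean curvature vector vanishes identically. -/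
def IsMaximal (ψ : S → L4) : Prop :=
  ∀ x : S, meanCurv ψ x = 0

end Surface

/-- An equation `q(x) = B(x, x) + l(x) + c = 0` of degree at most two. -/
structure Hyperquadric where
  form : LinearMap.BilinForm ℝ L4
  symm : ∀ x y : L4, form x y = form y x
  lin : L4 →ₗ[ℝ] ℝ
  const : ℝ

namespace Hyperquadric

/-- The function `q`. -/
def eval (Q : Hyperquadric) (x : L4) : ℝ := Q.form x x + Q.lin x + Q.const

/-- The differential `dq_x`. -/
def deriv (Q : Hyperquadric) (x v : L4) : ℝ := 2 * Q.form x v + Q.lin v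

/-- The hypersurface `{q = 0}`, without the points at which `dq` vanishes (such as the vertex of a
light cone). -/
def locus (Q : Hyperquadric) : Set L4 := {x | Q.eval x = 0 ∧ ∃ v, Q.deriv x v ≠ 0}

/-- The hypersurface is totally umbilical: at each of its points the second fundamental form, which
with respect to the normal `grad q` is `-Hess q = -2B` on the tangent space `ker dq_x`, is a
multiple of the induced metric. (The metric induced on the hypersurface may be degenerate.) -/
def IsTotallyUmbilical (Q : Hyperquadric) : Prop :=
  ∀ x ∈ Q.locus, ∃ μ : ℝ, ∀ v w : L4, Q.deriv x v = 0 → Q.deriv x w = 0 →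
    2 * Q.form v w = μ * lor v w

end Hyperquadric

/-- The affine hyperplane `⟨n, x⟩ = c`. -/
def hyperplane (n : L4) (c : ℝ) : Set L4 := {x | lor n x = c}

/-- The hyperquadric `⟨x - a, x - a⟩ = ρ` with centre `a`: for `ρ = 1/r²` the de Sitter space
`a + 𝕊³₁(r²)`, for `ρ = -1/r²` the two sheets of the hyperbolic space `a ± ℍ³(-r²)`, for `ρ = 0` the
light cone at `a` without its vertex. -/
def centralQuadric (a : L4) (ρ : ℝ) : Set L4 := {x | x ≠ a ∧ lor (x - a) (x - a) = ρ}

section Surface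

variable {S : Type*} [TopologicalSpace S] [ChartedSpace Plane S]

/-- `ν` is, at the point `x`, a unit normal of the surface `ψ` regarded as a surface in `Q`: it is
tangent to `Q`, orthogonal to the surface, and of square `1` or `-1`. -/
structure IsUnitNormalIn (ψ : S → L4) (Q : Hyperquadric) (x : S) (ν : L4) : Prop where
  tangent : Q.deriv (ψ x) ν = 0
  normal : ∀ v : Plane, lor ν (diff ψ x v) = 0
  unit : |lor ν ν| = 1

/-- The mean curvature of `ψ` as a surface in `Q` is constant. The mean curvature with respect to
the unit normal `ν` is `⟨H, ν⟩`, up to the sign `⟨ν, ν⟩`; since `ν` is only determined up to its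
sign, the absolute value is taken. (Where `Q` is degenerate there is no unit normal.) -/
def HasConstantMeanCurvIn (ψ : S → L4) (Q : Hyperquadric) : Prop :=
  ∃ h : ℝ, ∀ (x : S) (ν : L4), IsUnitNormalIn ψ Q x ν → |lor (meanCurv ψ x) ν| = h

end Surface

end Minkowski

end

/-
Near a point where `H ≠ 0` the normal bundle has a parallel null section `ν` with `⟨ν, H⟩ = 1`. If
`ξ` is any parallel normal field then `⟨ξ, H⟩ = c` is constant and `ξ + cψ` is traceless, and by the
Codazzi equation its Hopf function `w` in an orthonormal frame solves a Cauchy-Riemann type equation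
`(X + iY) w = a w`. By the Ricci equation the quotient of two Hopf functions is real, hence
constant. So a combination `ξ ≠ 0` of `ν` and `H` has vanishing Hopf function, which makes `ξ + cψ`
a constant `A`: the vector `A - cψ` is normal to the surface on some open set.

Unique continuation for `(X + iY) w = a w` propagates this normal from one open set to the next, and
so to all of `Σ` by connectedness. It holds because `log ‖w‖` satisfies an elliptic inequality, and
because `-exp(-rs)`, with `s` the squared distance to a point around which `w` vanishes, is for
large `r` a strict supersolution away from that point: by the maximum principle on an annulus, `w`
vanishes on every ball around the point in its domain.

If `A - mψ` is everywhere normal, `ψ` lies in a quadric `m⟨x, x⟩ - 2⟨A, x⟩ + c = 0`, whose normal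
at `ψ` is `A - mψ`. Since `⟨A - mψ, H⟩ = m`, `⟨A - mψ, A - mψ⟩` and `⟨H, H⟩` are constant, so is,
up to sign, the component of `H` in the normal plane orthogonal to `A - mψ` if this is not null.
-/

open VectorField Filter Topology Metric Set

namespace Minkowski

section DirectionalDerivative

variable {E F : Type*} [NormedAddCommGroup E] [NormedSpace ℝ E] [NormedAddCommGroup F]
  [NormedSpace ℝ F] {X Y : E → E} {f g : E → F} {Ω : Set E} {x : E}

/-- The derivative `X f` of a function along a vector field. -/
noncomputable def dirDeriv (X : E → E) (f : E → F) (x : E) : F :=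
  fderiv ℝ f x (X x)

theorem differentiableAt_of_contDiffOn (hf : ContDiffOn ℝ ∞ f Ω) (hΩ : IsOpen Ω) (hx : x ∈ Ω) :
    DifferentiableAt ℝ f x :=
  (hf.contDiffAt (hΩ.mem_nhds hx)).differentiableAt (by simp)

theorem contDiffOn_dirDeriv (hX : ContDiffOn ℝ ∞ X Ω) (hf : ContDiffOn ℝ ∞ f Ω) (hΩ : IsOpen Ω) :
    ContDiffOn ℝ ∞ (dirDeriv X f) Ω :=
  (hf.fderiv_of_isOpen hΩ (by simp)).clm_apply hX

theorem dirDeriv_eventuallyEq (h : f =ᶠ[𝓝 x] g) : dirDeriv X f =ᶠ[𝓝 x] dirDeriv X g :=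
  h.fderiv.mono fun y hy => by rw [dirDeriv, dirDeriv, hy]

theorem dirDeriv_add (hf : DifferentiableAt ℝ f x) (hg : DifferentiableAt ℝ g x) :
    dirDeriv X (fun y => f y + g y) x = dirDeriv X f x + dirDeriv X g x := by
  rw [dirDeriv, fderiv_fun_add hf hg, add_apply, dirDeriv, dirDeriv]

theorem dirDeriv_sub (hf : DifferentiableAt ℝ f x) (hg : DifferentiableAt ℝ g x) :
    dirDeriv X (fun y => f y - g y) x = dirDeriv X f x - dirDeriv X g x := by
  rw [dirDeriv, fderiv_fun_sub hf hg, sub_apply, dirDeriv, dirDeriv]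

theorem dirDeriv_neg : dirDeriv X (fun y => -f y) x = -dirDeriv X f x := by
  rw [dirDeriv, fderiv_fun_neg, neg_apply, dirDeriv]

theorem dirDeriv_const (c : F) : dirDeriv X (fun _ : E => c) x = 0 := by
  simp [dirDeriv]

theorem dirDeriv_mul {𝔸 : Type*} [NormedCommRing 𝔸] [NormedAlgebra ℝ 𝔸] {u v : E → 𝔸}
    (hu : DifferentiableAt ℝ u x) (hv : DifferentiableAt ℝ v x) :
    dirDeriv X (fun y => u y * v y) x = dirDeriv X u x * v x + u x * dirDeriv X v x := by
  rw [dirDeriv, fderiv_fun_mul hu hv, add_apply, smul_apply, smul_apply, dirDeriv, dirDeriv,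
    smul_eq_mul, smul_eq_mul]
  ring

theorem dirDeriv_clm_comp {G : Type*} [NormedAddCommGroup G] [NormedSpace ℝ G] (l : F →L[ℝ] G)
    (hf : DifferentiableAt ℝ f x) : dirDeriv X (fun y => l (f y)) x = l (dirDeriv X f x) :=
  DFunLike.congr_fun (l.hasFDerivAt.comp x hf.hasFDerivAt).fderiv (X x)

theorem dirDeriv_complex_mk {u v : E → ℝ} (hu : DifferentiableAt ℝ u x)
    (hv : DifferentiableAt ℝ v x) :
    dirDeriv X (fun y => (⟨u y, v y⟩ : ℂ)) x = ⟨dirDeriv X u x, dirDeriv X v x⟩ := by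
  have h : DifferentiableAt ℝ (fun y => (⟨u y, v y⟩ : ℂ)) x :=
    Complex.equivRealProdCLM.symm.differentiableAt.comp x (hu.prodMk hv)
  exact Complex.ext (dirDeriv_clm_comp Complex.reCLM h).symm
    (dirDeriv_clm_comp Complex.imCLM h).symm

theorem dirDeriv_add_const_smul (hf : DifferentiableAt ℝ f x) (hg : DifferentiableAt ℝ g x)
    (c : ℝ) : dirDeriv X (fun y => f y + c • g y) x = dirDeriv X f x + c • dirDeriv X g x := by
  rw [dirDeriv_add hf (hg.fun_const_smul c)]
  exact congrArg (_ + ·) (dirDeriv_clm_comp (c • ContinuousLinearMap.id ℝ F) hg)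

theorem dirDeriv_dirDeriv (hY : DifferentiableAt ℝ Y x) (hf : DifferentiableAt ℝ (fderiv ℝ f) x) :
    dirDeriv X (dirDeriv Y f) x =
      fderiv ℝ (fderiv ℝ f) x (X x) (Y x) + fderiv ℝ f x (fderiv ℝ Y x (X x)) := by
  unfold dirDeriv
  rw [fderiv_clm_apply hf hY, add_comm]
  rfl

theorem dirDeriv_commutator (hX : DifferentiableAt ℝ X x) (hY : DifferentiableAt ℝ Y x)
    (hf : ContDiffAt ℝ 2 f x) :
    dirDeriv X (dirDeriv Y f) x - dirDeriv Y (dirDeriv X f) x =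
      fderiv ℝ f x (lieBracket ℝ X Y x) := by
  rw [fderiv_apply_lieBracket hf (by simp) hY hX]
  rfl

theorem eventually_eq_of_eventually_fderiv_eq_zero (hf : ∀ᶠ y in 𝓝 x, DifferentiableAt ℝ f y)
    (h : ∀ᶠ y in 𝓝 x, fderiv ℝ f y = 0) : ∀ᶠ y in 𝓝 x, f y = f x := by
  obtain ⟨r, hr, hball⟩ := Metric.eventually_nhds_iff_ball.1 (hf.and h)
  filter_upwards [ball_mem_nhds x hr] with y hy
  exact isOpen_ball.is_const_of_fderiv_eq_zero (convex_ball x r).isPreconnected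
    (fun z hz => (hball z hz).1.differentiableWithinAt) (fun z hz => (hball z hz).2) hy
    (mem_ball_self hr)

theorem eventually_eq_zero_of_norm_fderiv_le {K : ℝ} (hg : ∀ᶠ y in 𝓝 x, DifferentiableAt ℝ g y)
    (hK : ∀ᶠ y in 𝓝 x, ‖fderiv ℝ g y‖ ≤ K * ‖g y‖) (hx : g x = 0) : ∀ᶠ y in 𝓝 x, g y = 0 := by
  obtain ⟨r, hr, hball⟩ := Metric.eventually_nhds_iff_ball.1 (hg.and hK)
  filter_upwards [ball_mem_nhds x hr] with y hy
  have hmem : ∀ t ∈ Icc (0 : ℝ) 1, AffineMap.lineMap x y t ∈ ball x r := fun t ht =>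
    (convex_ball x r).lineMap_mem (mem_ball_self hr) hy ht
  have hderiv : ∀ t ∈ Icc (0 : ℝ) 1, HasDerivAt (fun t => g (AffineMap.lineMap x y t))
      (fderiv ℝ g (AffineMap.lineMap x y t) (y - x)) t := fun t ht =>
    ((hball _ (hmem t ht)).1.hasFDerivAt).comp_hasDerivAt t AffineMap.hasDerivAt_lineMap
  have hzero := eq_zero_of_abs_deriv_le_mul_abs_self_of_eq_zero_right (K := K * ‖y - x‖)
    (fun t ht => (hderiv t ht).continuousAt.continuousWithinAt)
    (fun t ht => (hderiv t (Ico_subset_Icc_self ht)).hasDerivWithinAt) (by simpa using hx)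
    (fun t ht => by
      calc ‖fderiv ℝ g (AffineMap.lineMap x y t) (y - x)‖
          ≤ ‖fderiv ℝ g (AffineMap.lineMap x y t)‖ * ‖y - x‖ := ContinuousLinearMap.le_opNorm _ _
        _ ≤ K * ‖g (AffineMap.lineMap x y t)‖ * ‖y - x‖ := by
            gcongr
            exact (hball _ (hmem t (Ico_subset_Icc_self ht))).2
        _ = K * ‖y - x‖ * ‖g (AffineMap.lineMap x y t)‖ := by ring)
    1 (right_mem_Icc.2 zero_le_one)
  simpa using hzero

end DirectionalDerivative

section SecondDerivativeTest

variable {E : Type*} [NormedAddCommGroup E] [NormedSpace ℝ E]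

theorem deriv_deriv_nonpos_of_isLocalMax {g : ℝ → ℝ} {a : ℝ} (h : IsLocalMax g a)
    (hc : ContinuousAt g a) : deriv (deriv g) a ≤ 0 := by
  by_contra! hpos
  have hmin := isLocalMin_of_deriv_deriv_pos hpos h.deriv_eq_zero hc
  have hconst : g =ᶠ[𝓝 a] fun _ => g a := by
    filter_upwards [h, hmin] with t h₁ h₂ using le_antisymm h₁ h₂
  have hzero := hconst.deriv.deriv_eq
  simp only [deriv_const', deriv_const] at hzero
  exact hpos.ne' hzero

theorem dirDeriv_dirDeriv_self_nonpos_of_isLocalMax {X : E → E} {f : E → ℝ} {x : E}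
    (h : IsLocalMax f x) (hf : ContDiffAt ℝ 2 f x) (hX : DifferentiableAt ℝ X x) :
    dirDeriv X (dirDeriv X f) x ≤ 0 := by
  have hdf : DifferentiableAt ℝ (fderiv ℝ f) x :=
    (hf.fderiv_right (m := 1) (by norm_num)).differentiableAt (by simp)
  rw [dirDeriv_dirDeriv hX hdf, h.fderiv_eq_zero, zero_apply, add_zero]
  let line : ℝ → E := fun t => x + t • X x
  have hline : ∀ t, HasDerivAt line (X x) t := fun t =>
    one_smul ℝ (X x) ▸ ((hasDerivAt_id t).smul_const (X x)).const_add x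
  have hline0 : line 0 = x := by simp [line]
  have hcont : Tendsto line (𝓝 0) (𝓝 x) := hline0 ▸ (hline 0).continuousAt.tendsto
  have hfirst : deriv (f ∘ line) =ᶠ[𝓝 0] fun t => fderiv ℝ f (line t) (X x) := by
    filter_upwards [hcont.eventually (hf.eventually (by simp))] with t ht
    exact ((ht.differentiableAt (by simp)).hasFDerivAt.comp_hasDerivAt t (hline t)).deriv
  have hsecond : deriv (deriv (f ∘ line)) 0 = fderiv ℝ (fderiv ℝ f) x (X x) (X x) := by
    rw [hfirst.deriv_eq]
    have := (hline0.symm ▸ hdf.hasFDerivAt :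
      HasFDerivAt (fderiv ℝ f) (fderiv ℝ (fderiv ℝ f) x) (line 0)).comp_hasDerivAt 0 (hline 0)
    simpa using (this.clm_apply (hasDerivAt_const 0 (X x))).deriv
  rw [← hsecond]
  refine deriv_deriv_nonpos_of_isLocalMax ?_ ?_
  · filter_upwards [hcont.eventually h] with t ht
    simpa [hline0] using ht
  · exact (hline0.symm ▸ hf.continuousAt : ContinuousAt f (line 0)).comp (hline 0).continuousAt

end SecondDerivativeTest

section MovingFrames

variable {E : Type*} [NormedAddCommGroup E] [NormedSpace ℝ E] {X Y : E → E} {α β : E → ℝ}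
  {Ω : Set E} {x : E}

/-- The vector fields `X`, `Y` span the tangent spaces of `Ω`, which is hence at most
two-dimensional, and have the structure functions `α`, `β`, that is, `[X, Y] = αX + βY`. -/
structure IsMovingFrame (Ω : Set E) (X Y : E → E) (α β : E → ℝ) : Prop where
  isOpen : IsOpen Ω
  contDiffOn_fst : ContDiffOn ℝ ∞ X Ω
  contDiffOn_snd : ContDiffOn ℝ ∞ Y Ω
  contDiffOn_fst_coeff : ContDiffOn ℝ ∞ α Ω
  contDiffOn_snd_coeff : ContDiffOn ℝ ∞ β Ω
  spans : ∀ x ∈ Ω, ∀ v, ∃ s t : ℝ, v = s • X x + t • Y x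
  lieBracket_eq : ∀ x ∈ Ω, lieBracket ℝ X Y x = α x • X x + β x • Y x

namespace IsMovingFrame

theorem fderiv_eq_zero_iff {V : Type*} [NormedAddCommGroup V] [NormedSpace ℝ V]
    (hXY : IsMovingFrame Ω X Y α β) (hx : x ∈ Ω) {g : E → V} :
    fderiv ℝ g x = 0 ↔ dirDeriv X g x = 0 ∧ dirDeriv Y g x = 0 := by
  refine ⟨fun h => by simp [dirDeriv, h], fun ⟨hX, hY⟩ => ContinuousLinearMap.ext fun v => ?_⟩
  obtain ⟨s, t, rfl⟩ := hXY.spans x hx v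
  unfold dirDeriv at hX hY
  simp [hX, hY]

theorem dirDeriv_sq_add_dirDeriv_sq_pos (hXY : IsMovingFrame Ω X Y α β) (hx : x ∈ Ω) {s : E → ℝ}
    (hs : fderiv ℝ s x ≠ 0) : 0 < dirDeriv X s x ^ 2 + dirDeriv Y s x ^ 2 := by
  contrapose! hs
  have hX : dirDeriv X s x ^ 2 = 0 := by nlinarith [sq_nonneg (dirDeriv X s x)]
  have hY : dirDeriv Y s x ^ 2 = 0 := by nlinarith [sq_nonneg (dirDeriv Y s x)]
  exact (hXY.fderiv_eq_zero_iff hx).2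
    ⟨(pow_eq_zero_iff two_ne_zero).1 hX, (pow_eq_zero_iff two_ne_zero).1 hY⟩

end IsMovingFrame

end MovingFrames

section EllipticOperator

variable {E : Type*} [NormedAddCommGroup E] [NormedSpace ℝ E] {X Y : E → E} {α β : E → ℝ}
  {Ω : Set E} {x : E}

/-- The operator `X² + Y² + αY - βX`. If `[X, Y] = αX + βY`, it annihilates the real parts of the
solutions of `(X + iY)φ = 0`. -/
noncomputable def ellipticOp (X Y : E → E) (α β : E → ℝ) (v : E → ℝ) (x : E) : ℝ :=
  dirDeriv X (dirDeriv X v) x + dirDeriv Y (dirDeriv Y v) x + α x * dirDeriv Y v x -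
    β x * dirDeriv X v x

theorem contDiffOn_ellipticOp (hXY : IsMovingFrame Ω X Y α β) {v : E → ℝ}
    (hv : ContDiffOn ℝ ∞ v Ω) : ContDiffOn ℝ ∞ (ellipticOp X Y α β v) Ω := by
  have hXv := contDiffOn_dirDeriv hXY.contDiffOn_fst hv hXY.isOpen
  have hYv := contDiffOn_dirDeriv hXY.contDiffOn_snd hv hXY.isOpen
  exact (((contDiffOn_dirDeriv hXY.contDiffOn_fst hXv hXY.isOpen).add
    (contDiffOn_dirDeriv hXY.contDiffOn_snd hYv hXY.isOpen)).add
    (hXY.contDiffOn_fst_coeff.mul hYv)).sub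
    (hXY.contDiffOn_snd_coeff.mul hXv)

theorem differentiableAt_dirDeriv {F : Type*} [NormedAddCommGroup F] [NormedSpace ℝ F]
    {f : E → F} (hX : DifferentiableAt ℝ X x) (hf : ContDiffAt ℝ 2 f x) :
    DifferentiableAt ℝ (dirDeriv X f) x :=
  ((hf.fderiv_right (m := 1) (by norm_num)).differentiableAt (by simp)).clm_apply hX

theorem ellipticOp_nonpos_of_isLocalMax {v : E → ℝ} (h : IsLocalMax v x)
    (hv : ContDiffAt ℝ 2 v x) (hX : DifferentiableAt ℝ X x) (hY : DifferentiableAt ℝ Y x) :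
    ellipticOp X Y α β v x ≤ 0 := by
  have hfirst (Z : E → E) : dirDeriv Z v x = 0 := by
    rw [dirDeriv, h.fderiv_eq_zero, zero_apply]
  rw [ellipticOp, hfirst, hfirst]
  linarith [dirDeriv_dirDeriv_self_nonpos_of_isLocalMax h hv hX,
    dirDeriv_dirDeriv_self_nonpos_of_isLocalMax h hv hY]

theorem ellipticOp_sub_const_mul {u v : E → ℝ} (hu : ContDiffAt ℝ 2 u x) (hv : ContDiffAt ℝ 2 v x)
    (hX : DifferentiableAt ℝ X x) (hY : DifferentiableAt ℝ Y x) (k : ℝ) :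
    ellipticOp X Y α β (fun y => u y - k * v y) x =
      ellipticOp X Y α β u x - k * ellipticOp X Y α β v x := by
  have hfirst (Z : E → E) : dirDeriv Z (fun y => u y - k * v y) =ᶠ[𝓝 x]
      fun y => dirDeriv Z u y - k * dirDeriv Z v y := by
    filter_upwards [hu.eventually (by simp), hv.eventually (by simp)] with y huy hvy
    have hvy' := hvy.differentiableAt two_ne_zero
    rw [dirDeriv_sub (huy.differentiableAt two_ne_zero) (hvy'.const_mul k),
      dirDeriv_mul (differentiableAt_const k) hvy', dirDeriv_const, zero_mul, zero_add]
  have hsecond (Z : E → E) (hZ : DifferentiableAt ℝ Z x) :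
      dirDeriv Z (dirDeriv Z fun y => u y - k * v y) x =
        dirDeriv Z (dirDeriv Z u) x - k * dirDeriv Z (dirDeriv Z v) x := by
    have hZv := differentiableAt_dirDeriv hZ hv
    rw [(dirDeriv_eventuallyEq (hfirst Z)).eq_of_nhds,
      dirDeriv_sub (differentiableAt_dirDeriv hZ hu) (hZv.const_mul k),
      dirDeriv_mul (differentiableAt_const k) hZv, dirDeriv_const, zero_mul, zero_add]
  rw [ellipticOp, hsecond X hX, hsecond Y hY, (hfirst X).eq_of_nhds, (hfirst Y).eq_of_nhds,
    ellipticOp, ellipticOp]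
  ring

theorem ellipticOp_const_sub_exp (hXY : IsMovingFrame Ω X Y α β) {s : E → ℝ}
    (hs : ContDiffOn ℝ ∞ s Ω) (c r : ℝ) (hx : x ∈ Ω) :
    ellipticOp X Y α β (fun y => c - Real.exp (-(r * s y))) x =
      r * Real.exp (-(r * s x)) *
        (ellipticOp X Y α β s x - r * (dirDeriv X s x ^ 2 + dirDeriv Y s x ^ 2)) := by
  have hsd : ∀ y ∈ Ω, DifferentiableAt ℝ s y := fun y =>
    differentiableAt_of_contDiffOn hs hXY.isOpen
  have hexp : ∀ y ∈ Ω, DifferentiableAt ℝ (fun y => Real.exp (-(r * s y))) y := fun y hy =>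
    ((hsd y hy).const_mul r).fun_neg.exp
  have hexp' (Z : E → E) : ∀ y ∈ Ω, dirDeriv Z (fun y => Real.exp (-(r * s y))) y =
      -(r * Real.exp (-(r * s y)) * dirDeriv Z s y) := fun y hy => by
    rw [dirDeriv, fderiv_exp ((hsd y hy).const_mul r).fun_neg, fderiv_fun_neg,
      fderiv_const_mul (hsd y hy)]
    simp only [smul_apply, neg_apply, smul_eq_mul, dirDeriv]
    ring
  have hfirst (Z : E → E) : ∀ y ∈ Ω, dirDeriv Z (fun y => c - Real.exp (-(r * s y))) y =
      r * Real.exp (-(r * s y)) * dirDeriv Z s y := fun y hy => by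
    rw [dirDeriv_sub (differentiableAt_const c) (hexp y hy), dirDeriv_const, hexp' Z y hy]
    ring
  have hsecond (Z : E → E) (hZ : ContDiffOn ℝ ∞ Z Ω) :
      dirDeriv Z (dirDeriv Z fun y => c - Real.exp (-(r * s y))) x =
        r * Real.exp (-(r * s x)) * (dirDeriv Z (dirDeriv Z s) x - r * dirDeriv Z s x ^ 2) := by
    have heq : dirDeriv Z (fun y => c - Real.exp (-(r * s y))) =ᶠ[𝓝 x]
        fun y => r * Real.exp (-(r * s y)) * dirDeriv Z s y := by
      filter_upwards [hXY.isOpen.mem_nhds hx] using hfirst Z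
    rw [(dirDeriv_eventuallyEq heq).eq_of_nhds, dirDeriv_mul ((hexp x hx).const_mul r)
      (differentiableAt_of_contDiffOn (contDiffOn_dirDeriv hZ hs hXY.isOpen) hXY.isOpen hx),
      dirDeriv_mul (differentiableAt_const r) (hexp x hx), dirDeriv_const, hexp' Z x hx]
    ring
  rw [ellipticOp, hsecond X hXY.contDiffOn_fst, hsecond Y hXY.contDiffOn_snd, hfirst X x hx,
    hfirst Y x hx, ellipticOp]
  ring

/-- For large `r`, the function `-exp (-r s)` is a strict supersolution away from the points at
which `ds = 0`. -/
theorem exists_ellipticOp_const_sub_exp_neg (hXY : IsMovingFrame Ω X Y α β) {s : E → ℝ}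
    (hs : ContDiffOn ℝ ∞ s Ω) {K : Set E} (hK : IsCompact K) (hKΩ : K ⊆ Ω)
    (hds : ∀ x ∈ K, 0 < dirDeriv X s x ^ 2 + dirDeriv Y s x ^ 2) :
    ∃ r > 0, ∀ c, ∀ x ∈ K, ellipticOp X Y α β (fun y => c - Real.exp (-(r * s y))) x < 0 := by
  have hXs := contDiffOn_dirDeriv hXY.contDiffOn_fst hs hXY.isOpen
  have hYs := contDiffOn_dirDeriv hXY.contDiffOn_snd hs hXY.isOpen
  have hcont : ContinuousOn (fun x => ellipticOp X Y α β s x /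
      (dirDeriv X s x ^ 2 + dirDeriv Y s x ^ 2)) K :=
    ((contDiffOn_ellipticOp hXY hs).continuousOn.mono hKΩ).div
      (((hXs.pow 2).add (hYs.pow 2)).continuousOn.mono hKΩ) fun x hx => (hds x hx).ne'
  obtain ⟨C, hC⟩ := hK.bddAbove_image hcont
  refine ⟨max C 0 + 1, by positivity, fun c x hx => ?_⟩
  have hle : ellipticOp X Y α β s x ≤ C * (dirDeriv X s x ^ 2 + dirDeriv Y s x ^ 2) :=
    (div_le_iff₀ (hds x hx)).1 (hC (mem_image_of_mem _ hx))
  rw [ellipticOp_const_sub_exp hXY hs c _ (hKΩ hx)]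
  refine mul_neg_of_pos_of_neg (by positivity) ?_
  nlinarith [hds x hx, le_max_left C 0]

/-- Differentiating the equations and inserting them into `[X, Y]θ = αXθ + βYθ` eliminates `θ`. -/
theorem ellipticOp_eq_of_cauchyRiemann (hXY : IsMovingFrame Ω X Y α β) (hx : x ∈ Ω)
    {v θ a₁ a₂ : E → ℝ} (hθ : ContDiffAt ℝ 2 θ x) (ha₁ : DifferentiableAt ℝ a₁ x)
    (ha₂ : DifferentiableAt ℝ a₂ x)
    (h₁ : ∀ᶠ y in 𝓝 x, dirDeriv X v y = dirDeriv Y θ y + a₁ y)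
    (h₂ : ∀ᶠ y in 𝓝 x, dirDeriv Y v y = a₂ y - dirDeriv X θ y) :
    ellipticOp X Y α β v x =
      dirDeriv X a₁ x + dirDeriv Y a₂ x + α x * a₂ x - β x * a₁ x := by
  have hX := differentiableAt_of_contDiffOn hXY.contDiffOn_fst hXY.isOpen hx
  have hY := differentiableAt_of_contDiffOn hXY.contDiffOn_snd hXY.isOpen hx
  have hXX := (dirDeriv_eventuallyEq (X := X) h₁).eq_of_nhds
  have hYY := (dirDeriv_eventuallyEq (X := Y) h₂).eq_of_nhds
  rw [dirDeriv_add (differentiableAt_dirDeriv hY hθ) ha₁] at hXX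
  rw [dirDeriv_sub ha₂ (differentiableAt_dirDeriv hX hθ)] at hYY
  have hbracket := dirDeriv_commutator hX hY hθ
  rw [hXY.lieBracket_eq x hx, map_add, map_smul, map_smul, smul_eq_mul, smul_eq_mul] at hbracket
  change _ = α x * dirDeriv X θ x + β x * dirDeriv Y θ x at hbracket
  rw [ellipticOp, hXX, hYY, h₁.self_of_nhds, h₂.self_of_nhds]
  linear_combination hbracket

end EllipticOperator

section CauchyRiemann

variable {E : Type*} [NormedAddCommGroup E] [NormedSpace ℝ E] {X Y : E → E} {α β : E → ℝ}
  {Ω : Set E} {w a : E → ℂ} {x : E}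

/-- A smooth solution of the Cauchy-Riemann type equation `(X + iY)w = aw`. -/
structure IsCauchyRiemannSolution (Ω : Set E) (X Y : E → E) (a w : E → ℂ) : Prop where
  contDiffOn_coeff : ContDiffOn ℝ ∞ a Ω
  contDiffOn : ContDiffOn ℝ ∞ w Ω
  eq : ∀ x ∈ Ω, dirDeriv X w x + Complex.I * dirDeriv Y w x = a x * w x

theorem exists_local_log (hΩ : IsOpen Ω) (hw : ContDiffOn ℝ ∞ w Ω) (hx : x ∈ Ω) (hwx : w x ≠ 0) :
    ∃ φ : E → ℂ, ContDiffAt ℝ ∞ φ x ∧ ∀ᶠ y in 𝓝 x, w y = w x * Complex.exp (φ y) := by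
  have hq : ContDiffAt ℝ ∞ (fun y => w y / w x) x := by
    simpa only [div_eq_mul_inv] using (hw.contDiffAt (hΩ.mem_nhds hx)).mul contDiffAt_const
  refine ⟨fun y => Complex.log (w y / w x), ?_, ?_⟩
  · have hlog : ContDiffAt ℝ ∞ Complex.log (w x / w x) :=
      (Complex.contDiffAt_log (by simp [hwx])).restrict_scalars ℝ
    exact hlog.comp x hq
  · filter_upwards [hq.continuousAt.eventually_ne (by simp [hwx] : w x / w x ≠ 0)] with y hy
    rw [Complex.exp_log hy, mul_div_cancel₀ _ hwx]

theorem dirDeriv_of_eventuallyEq_mul_exp {c : ℂ} {φ : E → ℂ} (hφ : DifferentiableAt ℝ φ x)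
    (h : w =ᶠ[𝓝 x] fun y => c * Complex.exp (φ y)) :
    dirDeriv X w x = w x * dirDeriv X φ x := by
  rw [(dirDeriv_eventuallyEq h).eq_of_nhds, h.eq_of_nhds,
    dirDeriv_mul (differentiableAt_const c) hφ.cexp, dirDeriv_const, zero_mul, zero_add, dirDeriv,
    (hφ.hasFDerivAt.cexp).fderiv, smul_apply, smul_eq_mul, dirDeriv]
  ring

theorem contDiffAt_log_norm (hw : ContDiffAt ℝ ∞ w x) (hwx : w x ≠ 0) :
    ContDiffAt ℝ ∞ (fun y => Real.log ‖w y‖) x :=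
  (hw.norm ℝ hwx).log (norm_ne_zero_iff.2 hwx)

theorem IsCauchyRiemannSolution.eventually_dirDeriv_log_eq
    (hw : IsCauchyRiemannSolution Ω X Y a w) (hΩ : IsOpen Ω) (hx : x ∈ Ω) (hwx : w x ≠ 0)
    {c : ℂ} {φ : E → ℂ} (hφ : ∀ᶠ y in 𝓝 x, DifferentiableAt ℝ φ y)
    (hexp : w =ᶠ[𝓝 x] fun y => c * Complex.exp (φ y)) :
    ∀ᶠ y in 𝓝 x, dirDeriv X φ y + Complex.I * dirDeriv Y φ y = a y := by
  have hΩx := hΩ.mem_nhds hx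
  filter_upwards [hφ, hexp.eventually_nhds, hΩx,
    (hw.contDiffOn.continuousOn.continuousAt hΩx).eventually_ne hwx] with y hy hey hyΩ hwy
  refine mul_left_cancel₀ hwy ?_
  have h := hw.eq y hyΩ
  rw [dirDeriv_of_eventuallyEq_mul_exp hy hey, dirDeriv_of_eventuallyEq_mul_exp hy hey] at h
  linear_combination h

/-- The logarithm of `w` solves `(X + iY)φ = a`, and `log ‖w‖` is its real part. -/
theorem IsCauchyRiemannSolution.ellipticOp_log_norm (hw : IsCauchyRiemannSolution Ω X Y a w)
    (hXY : IsMovingFrame Ω X Y α β) (hx : x ∈ Ω) (hwx : w x ≠ 0) :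
    ellipticOp X Y α β (fun y => Real.log ‖w y‖) x =
      dirDeriv X (fun y => (a y).re) x + dirDeriv Y (fun y => (a y).im) x + α x * (a x).im -
        β x * (a x).re := by
  obtain ⟨φ, hφ, hexp⟩ := exists_local_log hXY.isOpen hw.contDiffOn hx hwx
  have hφ' : ∀ᶠ y in 𝓝 x, DifferentiableAt ℝ φ y :=
    ((hφ.of_le (by simp) : ContDiffAt ℝ 1 φ x).eventually (by simp)).mono fun y hy =>
      hy.differentiableAt one_ne_zero
  have hlog : ∀ᶠ y in 𝓝 x, (fun y => Real.log ‖w y‖) =ᶠ[𝓝 y]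
      fun y => (φ y).re + Real.log ‖w x‖ := by
    refine (hexp.mono fun y hy => ?_).eventually_nhds
    beta_reduce
    rw [hy, norm_mul, Complex.norm_exp, Real.log_mul (norm_ne_zero_iff.2 hwx)
      (Real.exp_ne_zero _), Real.log_exp, add_comm]
  have hre (Z : E → E) {y : E} (hy : DifferentiableAt ℝ φ y)
      (hlogy : (fun y => Real.log ‖w y‖) =ᶠ[𝓝 y] fun y => (φ y).re + Real.log ‖w x‖) :
      dirDeriv Z (fun y => Real.log ‖w y‖) y = (dirDeriv Z φ y).re := by
    have hre : DifferentiableAt ℝ (fun y => (φ y).re) y :=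
      Complex.reCLM.differentiableAt.comp y hy
    rw [(dirDeriv_eventuallyEq hlogy).eq_of_nhds, dirDeriv_add hre (differentiableAt_const _),
      dirDeriv_const, add_zero]
    exact dirDeriv_clm_comp Complex.reCLM hy
  have him (Z : E → E) {y : E} (hy : DifferentiableAt ℝ φ y) :
      dirDeriv Z (fun y => (φ y).im) y = (dirDeriv Z φ y).im :=
    dirDeriv_clm_comp Complex.imCLM hy
  have hCR := hw.eventually_dirDeriv_log_eq hXY.isOpen hx hwx hφ' hexp
  have ha := differentiableAt_of_contDiffOn hw.contDiffOn_coeff hXY.isOpen hx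
  refine ellipticOp_eq_of_cauchyRiemann hXY hx (θ := fun y => (φ y).im)
    (Complex.imCLM.contDiff.contDiffAt.comp x (hφ.of_le (by norm_cast)))
    (Complex.reCLM.differentiableAt.comp x ha) (Complex.imCLM.differentiableAt.comp x ha) ?_ ?_
  all_goals
    filter_upwards [hφ', hlog, hCR] with y hy hlogy hCRy
    rw [hre _ hy hlogy, him _ hy, ← hCRy]
    simp

end CauchyRiemann

section Comparison

variable {E : Type*} [NormedAddCommGroup E] [NormedSpace ℝ E] {X Y : E → E} {α β : E → ℝ}
  {Ω : Set E} {w a : E → ℂ}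

theorem IsCauchyRiemannSolution.exists_ellipticOp_log_norm_gt
    (hw : IsCauchyRiemannSolution Ω X Y a w) (hXY : IsMovingFrame Ω X Y α β) {K : Set E}
    (hK : IsCompact K) (hKΩ : K ⊆ Ω) {g : E → ℝ} (hg : ContDiffOn ℝ ∞ g Ω)
    (hLg : ∀ x ∈ K, ellipticOp X Y α β g x < 0) :
    ∃ C, ∀ k > C, ∀ x ∈ K, w x ≠ 0 →
      k * ellipticOp X Y α β g x < ellipticOp X Y α β (fun y => Real.log ‖w y‖) x := by
  have hre : ContDiffOn ℝ ∞ (fun y => (a y).re) Ω :=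
    Complex.reCLM.contDiff.comp_contDiffOn hw.contDiffOn_coeff
  have him : ContDiffOn ℝ ∞ (fun y => (a y).im) Ω :=
    Complex.imCLM.contDiff.comp_contDiffOn hw.contDiffOn_coeff
  have hrhs := (((contDiffOn_dirDeriv hXY.contDiffOn_fst hre hXY.isOpen).add
    (contDiffOn_dirDeriv hXY.contDiffOn_snd him hXY.isOpen)).add
    (hXY.contDiffOn_fst_coeff.mul him)).sub (hXY.contDiffOn_snd_coeff.mul hre)
  obtain ⟨C, hC⟩ := hK.bddAbove_image ((hrhs.continuousOn.mono hKΩ).div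
    ((contDiffOn_ellipticOp hXY hg).continuousOn.mono hKΩ) fun x hx => (hLg x hx).ne)
  refine ⟨C, fun k hk x hx hwx => ?_⟩
  rw [hw.ellipticOp_log_norm hXY (hKΩ hx) hwx]
  exact (div_lt_iff_of_neg (hLg x hx)).1 ((hC (mem_image_of_mem _ hx)).trans_lt hk)

theorem eventually_exists_isMaxOn_norm_mul_exp {T V : Type*} [TopologicalSpace T]
    [NormedAddCommGroup V] {K : Set T} (hK : IsCompact K) {u : T → V} {g : T → ℝ}
    (hu : ContinuousOn u K) (hg : ContinuousOn g K) {x₁ : T} (hx₁ : x₁ ∈ K) (hgx₁ : g x₁ < 0)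
    (hux₁ : u x₁ ≠ 0) :
    ∀ᶠ k in atTop, ∃ z ∈ K, IsMaxOn (fun y => ‖u y‖ * Real.exp (k * -g y)) K z ∧ g z < 0 ∧
      u z ≠ 0 := by
  obtain ⟨M, hM⟩ := hK.bddAbove_image hu.norm
  have hgrow : Tendsto (fun k : ℝ => ‖u x₁‖ * Real.exp (k * -g x₁)) atTop atTop :=
    (Real.tendsto_exp_atTop.comp (tendsto_id.atTop_mul_const (neg_pos.2 hgx₁))).const_mul_atTop
      (norm_pos_iff.2 hux₁)
  filter_upwards [eventually_gt_atTop 0, hgrow.eventually_gt_atTop M] with k hk₀ hkM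
  obtain ⟨z, hzK, hz⟩ := hK.exists_isMaxOn ⟨x₁, hx₁⟩ (hu.norm.mul (hg.neg.const_mul k).rexp)
  have hMz : M < ‖u z‖ * Real.exp (k * -g z) := hkM.trans_le (hz hx₁)
  have huzM : ‖u z‖ ≤ M := hM (mem_image_of_mem _ hzK)
  refine ⟨z, hzK, hz, ?_, fun h => ?_⟩
  · by_contra! hgz
    have : Real.exp (k * -g z) ≤ 1 := Real.exp_le_one_iff.2 (by nlinarith)
    nlinarith [norm_nonneg (u z)]
  · rw [h, norm_zero] at huzM hMz
    linarith

theorem isLocalMax_log_norm_sub_const_mul {T V : Type*} [TopologicalSpace T]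
    [NormedAddCommGroup V] {u : T → V} {g : T → ℝ} {k : ℝ} {z : T}
    (hz : IsLocalMax (fun y => ‖u y‖ * Real.exp (k * -g y)) z) (hu : ContinuousAt u z)
    (huz : u z ≠ 0) : IsLocalMax (fun y => Real.log ‖u y‖ - k * g y) z := by
  have hlog {y : T} (huy : u y ≠ 0) :
      Real.log (‖u y‖ * Real.exp (k * -g y)) = Real.log ‖u y‖ - k * g y := by
    rw [Real.log_mul (norm_ne_zero_iff.2 huy) (Real.exp_ne_zero _), Real.log_exp]
    ring
  filter_upwards [hz, hu.eventually_ne huz] with y hy huy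
  rw [← hlog huy, ← hlog huz]
  exact Real.log_le_log (mul_pos (norm_pos_iff.2 huy) (Real.exp_pos _)) hy

/-- For large `k`, the maximum of `‖w‖ exp (-kg)` over `K` would be interior, and
`log ‖w‖ - kg` a strict subsolution there. -/
theorem IsCauchyRiemannSolution.eq_zero_of_supersolution_neg
    (hw : IsCauchyRiemannSolution Ω X Y a w) (hXY : IsMovingFrame Ω X Y α β) {K : Set E}
    (hK : IsCompact K) (hKΩ : K ⊆ Ω) {g : E → ℝ} (hg : ContDiffOn ℝ ∞ g Ω)
    (hLg : ∀ x ∈ K, ellipticOp X Y α β g x < 0)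
    (hint : ∀ x ∈ K, g x < 0 → w x ≠ 0 → K ∈ 𝓝 x) {x₁ : E} (hx₁ : x₁ ∈ K) (hgx₁ : g x₁ < 0) :
    w x₁ = 0 := by
  by_contra hwx₁
  obtain ⟨C, hC⟩ := hw.exists_ellipticOp_log_norm_gt hXY hK hKΩ hg hLg
  obtain ⟨k, hkC, z, hzK, hz, hgz, hwz⟩ := ((eventually_gt_atTop C).and
    (eventually_exists_isMaxOn_norm_mul_exp hK (hw.contDiffOn.continuousOn.mono hKΩ)
      (hg.continuousOn.mono hKΩ) hx₁ hgx₁ hwx₁)).exists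
  have hzΩ := hKΩ hzK
  have hwz' := hw.contDiffOn.contDiffAt (hXY.isOpen.mem_nhds hzΩ)
  have hmax := isLocalMax_log_norm_sub_const_mul
    (hz.isLocalMax (hint z hzK hgz hwz)) hwz'.continuousAt hwz
  have hXz := differentiableAt_of_contDiffOn hXY.contDiffOn_fst hXY.isOpen hzΩ
  have hYz := differentiableAt_of_contDiffOn hXY.contDiffOn_snd hXY.isOpen hzΩ
  have hlog := (contDiffAt_log_norm hwz' hwz).of_le (m := 2) (by norm_cast)
  have hgz' := (hg.contDiffAt (hXY.isOpen.mem_nhds hzΩ)).of_le (m := 2) (by norm_cast)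
  have hle := ellipticOp_nonpos_of_isLocalMax (α := α) (β := β) hmax
    (hlog.sub (contDiffAt_const.mul hgz')) hXz hYz
  rw [ellipticOp_sub_const_mul hlog hgz' hXz hYz] at hle
  linarith [hC k hkC z hzK hwz]

end Comparison

section Propagation

variable {E : Type*} [NormedAddCommGroup E] [InnerProductSpace ℝ E]
  {X Y : E → E} {α β : E → ℝ} {Ω : Set E} {w a : E → ℂ} {x₀ : E}

theorem IsCauchyRiemannSolution.eq_zero_on_ball [ProperSpace E]
    (hw : IsCauchyRiemannSolution Ω X Y a w) (hXY : IsMovingFrame Ω X Y α β) {R : ℝ}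
    (hR : closedBall x₀ R ⊆ Ω) (h₀ : ∀ᶠ x in 𝓝 x₀, w x = 0) : ∀ x ∈ ball x₀ R, w x = 0 := by
  intro x₁ hx₁
  obtain ⟨r, hr, hwr⟩ := Metric.eventually_nhds_iff_ball.1 h₀
  by_cases hx₁r : x₁ ∈ ball x₀ r
  · exact hwr x₁ hx₁r
  have hs : ContDiff ℝ ∞ fun x => ‖x - x₀‖ ^ 2 := (contDiff_id.sub contDiff_const).norm_sq ℝ
  have hKΩ : closedBall x₀ R \ ball x₀ (r / 2) ⊆ Ω := sdiff_subset.trans hR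
  have hK : IsCompact (closedBall x₀ R \ ball x₀ (r / 2)) :=
    (isCompact_closedBall x₀ R).diff isOpen_ball
  obtain ⟨k, hk, hLk⟩ := exists_ellipticOp_const_sub_exp_neg hXY hs.contDiffOn hK hKΩ
    fun x hx => hXY.dirDeriv_sq_add_dirDeriv_sq_pos (hKΩ hx) fun h => by
      have hx₀ : 0 < ‖x - x₀‖ := (half_pos hr).trans_le (by simpa [dist_eq_norm] using hx.2)
      have hd : HasFDerivAt (fun x => ‖x - x₀‖ ^ 2) _ x :=
        ((hasFDerivAt_id x).sub_const x₀).norm_sq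
      have hdx : fderiv ℝ (fun x => ‖x - x₀‖ ^ 2) x (x - x₀) = 0 := by rw [h, zero_apply]
      exact norm_pos_iff.1 hx₀ (by simpa [hd.fderiv, ← inner_sub_left] using hdx)
  have hneg {x : E} : Real.exp (-(k * R ^ 2)) - Real.exp (-(k * ‖x - x₀‖ ^ 2)) < 0 ↔
      ‖x - x₀‖ < R := by
    rw [sub_neg, Real.exp_lt_exp, neg_lt_neg_iff, mul_lt_mul_iff_right₀ hk,
      pow_lt_pow_iff_left₀ (norm_nonneg _) (dist_nonneg.trans (mem_ball.1 hx₁).le) two_ne_zero]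
  refine hw.eq_zero_of_supersolution_neg hXY hK hKΩ
    (contDiff_const.sub (contDiff_const.mul hs).neg.exp).contDiffOn (hLk (Real.exp (-(k * R ^ 2))))
    (fun x _ hgx hwx => ?_)
    ⟨ball_subset_closedBall hx₁, fun h => hx₁r (ball_subset_ball (by linarith) h)⟩
    (hneg.2 (mem_ball_iff_norm.1 hx₁))
  have hxr : x ∉ closedBall x₀ (r / 2) := fun h =>
    hwx (hwr x (closedBall_subset_ball (half_lt_self hr) h))
  filter_upwards [isOpen_ball.mem_nhds (mem_ball_iff_norm.2 (hneg.1 hgx)),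
    isClosed_closedBall.isOpen_compl.mem_nhds hxr] with y hyR hyr
  exact ⟨ball_subset_closedBall hyR, fun h => hyr (ball_subset_closedBall h)⟩

/-- Every point of the closure of the interior of the zero set is close to a point of that
interior, around which the zero set contains a large ball. -/
theorem IsCauchyRiemannSolution.eq_zero_of_isPreconnected [ProperSpace E]
    (hw : IsCauchyRiemannSolution Ω X Y a w) (hXY : IsMovingFrame Ω X Y α β)
    (hΩ : IsPreconnected Ω) (hx₀ : x₀ ∈ Ω) (h₀ : ∀ᶠ x in 𝓝 x₀, w x = 0) :
    ∀ x ∈ Ω, w x = 0 := by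
  have hsub : Ω ⊆ {x | ∀ᶠ y in 𝓝 x, w y = 0} := by
    refine hΩ.subset_of_closure_inter_subset isOpen_setOfPred_eventually_nhds ⟨x₀, hx₀, h₀⟩ ?_
    rintro x ⟨hxcl, hxΩ⟩
    obtain ⟨R, hR, hRΩ⟩ := nhds_basis_closedBall.mem_iff.1 (hXY.isOpen.mem_nhds hxΩ)
    obtain ⟨z, hz, hxz⟩ := Metric.mem_closure_iff.1 hxcl (R / 2) (half_pos hR)
    rw [dist_comm] at hxz
    filter_upwards [isOpen_ball.mem_nhds (mem_ball'.2 hxz)] using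
      hw.eq_zero_on_ball hXY ((closedBall_subset_closedBall' (by linarith)).trans hRΩ) hz
  exact fun x hx => (hsub hx).self_of_nhds

end Propagation

section LorentzianAlgebra

variable {a b n w x y z ν : L4}

theorem lor_comm (x y : L4) : lor x y = lor y x := by
  unfold lor; ring

theorem lor_add_left (x y z : L4) : lor (x + y) z = lor x z + lor y z := by
  simp only [lor, Pi.add_apply]; ring

theorem lor_smul_left (c : ℝ) (x y : L4) : lor (c • x) y = c * lor x y := by
  simp only [lor, Pi.smul_apply, smul_eq_mul]; ring

/-- The Lorentzian product as a bilinear form. -/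
noncomputable def lorForm : LinearMap.BilinForm ℝ L4 :=
  LinearMap.mk₂ ℝ lor lor_add_left lor_smul_left
    (fun x y z => by rw [lor_comm, lor_add_left, lor_comm y, lor_comm z])
    (fun c x y => by rw [lor_comm, lor_smul_left, lor_comm y, smul_eq_mul])

theorem lorForm_apply (x y : L4) : lorForm x y = lor x y :=
  rfl

theorem lor_add_right (x y z : L4) : lor x (y + z) = lor x y + lor x z :=
  (lorForm x).map_add y z

theorem lor_smul_right (c : ℝ) (x y : L4) : lor x (c • y) = c * lor x y :=
  (lorForm x).map_smul c y

theorem lor_sub_left (x y z : L4) : lor (x - y) z = lor x z - lor y z :=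
  lorForm.map_sub₂ x y z

theorem lor_sub_right (x y z : L4) : lor x (y - z) = lor x y - lor x z :=
  (lorForm x).map_sub y z

theorem lor_neg_right (x y : L4) : lor x (-y) = -lor x y :=
  (lorForm x).map_neg y

theorem lor_neg_left (x y : L4) : lor (-x) y = -lor x y := by
  rw [lor_comm, lor_neg_right, lor_comm]

theorem lor_zero_left (y : L4) : lor 0 y = 0 :=
  lorForm.map_zero₂ y

theorem eq_zero_of_forall_lor_eq_zero (h : ∀ y, lor x y = 0) : x = 0 := by
  ext i
  have := h (Pi.single i 1)
  fin_cases i <;> simpa [lor] using this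

/-- `a`, `b` is an orthonormal basis of a spacelike plane. -/
structure IsOrthonormalPair (a b : L4) : Prop where
  fst : lor a a = 1
  snd : lor b b = 1
  fst_snd : lor a b = 0

/-- The component of `w` orthogonal to the plane of an orthonormal pair `a`, `b`. -/
def perp (a b w : L4) : L4 := w - lor w a • a - lor w b • b

theorem eq_of_perp_eq_zero (h : perp a b w = 0) : w = lor w a • a + lor w b • b := by
  rw [perp, sub_sub, sub_eq_zero] at h
  exact h

theorem IsOrthonormalPair.lor_snd_fst (hab : IsOrthonormalPair a b) : lor b a = 0 :=
  lor_comm b a ▸ hab.fst_snd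

theorem IsOrthonormalPair.lor_perp_fst (hab : IsOrthonormalPair a b) (w : L4) :
    lor (perp a b w) a = 0 := by
  simp only [perp, lor_sub_left, lor_smul_left, hab.fst, hab.lor_snd_fst]
  ring

theorem IsOrthonormalPair.lor_perp_snd (hab : IsOrthonormalPair a b) (w : L4) :
    lor (perp a b w) b = 0 := by
  simp only [perp, lor_sub_left, lor_smul_left, hab.snd, hab.fst_snd]
  ring

theorem lor_perp_right_of_orthogonal (ha : lor x a = 0) (hb : lor x b = 0) (w : L4) :
    lor x (perp a b w) = lor x w := by
  simp only [perp, lor_sub_right, lor_smul_right, ha, hb]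
  ring

theorem IsOrthonormalPair.eq_zero_of_normal (hab : IsOrthonormalPair a b) (ha : lor x a = 0)
    (hb : lor x b = 0) (h : ∀ n, lor n a = 0 → lor n b = 0 → lor x n = 0) : x = 0 :=
  eq_zero_of_forall_lor_eq_zero fun y => by
    rw [← lor_perp_right_of_orthogonal ha hb]
    exact h _ (hab.lor_perp_fst y) (hab.lor_perp_snd y)

theorem IsOrthonormalPair.eq_of_orthogonal_normals (hab : IsOrthonormalPair a b)
    (h : ∀ n, lor n a = 0 → lor n b = 0 → lor w n = 0) : w = lor w a • a + lor w b • b :=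
  eq_of_perp_eq_zero <| hab.eq_zero_of_normal (hab.lor_perp_fst w) (hab.lor_perp_snd w)
    fun n ha hb => by
      rw [lor_comm, lor_perp_right_of_orthogonal ha hb, lor_comm]
      exact h n ha hb

theorem IsOrthonormalPair.not_linearIndependent_of_normal (hab : IsOrthonormalPair a b)
    {p : Fin 3 → L4} (ha : ∀ i, lor (p i) a = 0) (hb : ∀ i, lor (p i) b = 0) :
    ¬LinearIndependent ℝ p := by
  intro hp
  have hperp {u : L4} {k : ℕ} {q : Fin k → L4} (hu : lor u u = 1) (hq : ∀ i, lor (q i) u = 0) :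
      u ∉ Submodule.span ℝ (range q) := fun hmem => by
    have hle : Submodule.span ℝ (range q) ≤ LinearMap.ker (lorForm.flip u) :=
      Submodule.span_le.2 (range_subset_iff.2 hq)
    exact one_ne_zero (hu.symm.trans (hle hmem))
  have hind := linearIndependent_finCons.2
    ⟨linearIndependent_finCons.2 ⟨hp, hperp hab.snd hb⟩,
      hperp hab.fst (Fin.cases hab.lor_snd_fst ha)⟩
  simpa using hind.fintype_card_le_finrank

/-- The plane of normals is two-dimensional. -/
theorem IsOrthonormalPair.det_lor_eq_zero (hab : IsOrthonormalPair a b) {p : Fin 3 → L4}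
    (ha : ∀ i, lor (p i) a = 0) (hb : ∀ i, lor (p i) b = 0) (q : Fin 3 → L4) :
    (Matrix.of fun i j => lor (p i) (q j)).det = 0 := by
  have hdep := hab.not_linearIndependent_of_normal ha hb
  rw [Fintype.not_linearIndependent_iff] at hdep
  obtain ⟨c, hc, i, hi⟩ := hdep
  refine Matrix.exists_vecMul_eq_zero_iff.1 ⟨c, fun h => hi (congrFun h i), funext fun j => ?_⟩
  have := congrArg (lorForm.flip (q j)) hc
  rw [map_sum, map_zero] at this
  simpa [Matrix.vecMul, dotProduct, lorForm_apply] using this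

theorem IsOrthonormalPair.eq_zero_of_orthogonal_normal_basis (hab : IsOrthonormalPair a b)
    {n m : L4} (hna : lor n a = 0) (hnb : lor n b = 0) (hma : lor m a = 0) (hmb : lor m b = 0)
    (hnm : lor n n * lor m m - lor n m ^ 2 ≠ 0) (hxa : lor x a = 0) (hxb : lor x b = 0)
    (hxn : lor x n = 0) (hxm : lor x m = 0) : x = 0 := by
  refine hab.eq_zero_of_normal hxa hxb fun y _ _ => ?_
  have hdet := hab.det_lor_eq_zero (p := ![n, m, x]) (by simp [Fin.forall_fin_succ, *])
    (by simp [Fin.forall_fin_succ, *]) ![n, m, y]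
  simp only [Matrix.det_fin_three, Matrix.of_apply, Matrix.cons_val, hxn, hxm, lor_comm m n]
    at hdet
  refine (mul_eq_zero.1 (?_ : (lor n n * lor m m - lor n m ^ 2) * lor x y = 0)).resolve_left hnm
  linear_combination hdet

theorem IsOrthonormalPair.lor_self_ne_zero (hab : IsOrthonormalPair a b) (hna : lor n a = 0)
    (hnb : lor n b = 0) (hνa : lor ν a = 0) (hνb : lor ν b = 0) (hn : n ≠ 0) (hnν : lor n ν = 0)
    (hν : lor ν ν ≠ 0) : lor n n ≠ 0 := by
  refine fun hnn => hn (hab.eq_zero_of_normal hna hnb fun y hya hyb => ?_)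
  have hdet := hab.det_lor_eq_zero (p := ![n, ν, y]) (by simp [Fin.forall_fin_succ, *])
    (by simp [Fin.forall_fin_succ, *]) ![n, ν, y]
  simp only [Matrix.det_fin_three, Matrix.of_apply, Matrix.cons_val, hnn, hnν, lor_comm ν n,
    lor_comm y n] at hdet
  refine (pow_eq_zero_iff two_ne_zero).1 ((mul_eq_zero.1 ?_).resolve_left hν)
  linear_combination -hdet

theorem IsOrthonormalPair.abs_lor_eq_sqrt (hab : IsOrthonormalPair a b) (hna : lor n a = 0)
    (hnb : lor n b = 0) (hνa : lor ν a = 0) (hνb : lor ν b = 0) (hxa : lor x a = 0)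
    (hxb : lor x b = 0) (hn : n ≠ 0) (hnν : lor n ν = 0) (hν : |lor ν ν| = 1) :
    |lor x ν| = √|lor x x - lor n x ^ 2 / lor n n| := by
  have hnn := hab.lor_self_ne_zero hna hnb hνa hνb hn hnν (abs_ne_zero.1 (hν ▸ one_ne_zero))
  have hdet := hab.det_lor_eq_zero (p := ![n, ν, x]) (by simp [Fin.forall_fin_succ, *])
    (by simp [Fin.forall_fin_succ, *]) ![n, ν, x]
  simp only [Matrix.det_fin_three, Matrix.of_apply, Matrix.cons_val, hnν, lor_comm ν n,
    lor_comm x n, lor_comm ν x] at hdet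
  have hsq : lor x ν ^ 2 = lor ν ν * (lor x x - lor n x ^ 2 / lor n n) := by
    field_simp
    linear_combination -hdet
  rw [← Real.sqrt_sq_eq_abs, ← abs_sq, hsq, abs_mul, hν, one_mul]

/-- The Lorentzian vector product of three vectors. -/
def cross (a b c : L4) : L4 :=
  ![-(a 1 * (b 2 * c 3 - b 3 * c 2) - a 2 * (b 1 * c 3 - b 3 * c 1) +
        a 3 * (b 1 * c 2 - b 2 * c 1)),
    -(a 0 * (b 2 * c 3 - b 3 * c 2) - a 2 * (b 0 * c 3 - b 3 * c 0) +
        a 3 * (b 0 * c 2 - b 2 * c 0)),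
    a 0 * (b 1 * c 3 - b 3 * c 1) - a 1 * (b 0 * c 3 - b 3 * c 0) +
      a 3 * (b 0 * c 1 - b 1 * c 0),
    -(a 0 * (b 1 * c 2 - b 2 * c 1) - a 1 * (b 0 * c 2 - b 2 * c 0) +
        a 2 * (b 0 * c 1 - b 1 * c 0))]

theorem lor_cross_fst (a b c : L4) : lor (cross a b c) a = 0 := by
  simp only [lor, cross, Matrix.cons_val]; ring

theorem lor_cross_snd (a b c : L4) : lor (cross a b c) b = 0 := by
  simp only [lor, cross, Matrix.cons_val]; ring

theorem lor_cross_trd (a b c : L4) : lor (cross a b c) c = 0 := by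
  simp only [lor, cross, Matrix.cons_val]; ring

theorem IsOrthonormalPair.lor_cross_cross (hab : IsOrthonormalPair a b) {c : L4}
    (ha : lor c a = 0) (hb : lor c b = 0) :
    lor (cross a b c) (cross a b c) = -lor c c := by
  have hgram : lor (cross a b c) (cross a b c) =
      -(lor a a * (lor b b * lor c c - lor c b ^ 2) -
        lor a b * (lor a b * lor c c - lor c b * lor c a) +
        lor c a * (lor a b * lor c b - lor b b * lor c a)) := by
    simp only [lor, cross, Matrix.cons_val]; ring
  rw [hgram, hab.fst, hab.snd, hab.fst_snd, ha, hb]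
  ring

/-- The normal component of the unit vector of the time axis. -/
def timeNormal (a b : L4) : L4 := perp a b (Pi.single 0 1)

/-- The two null normals of the plane of an orthonormal pair `a`, `b`, for `ε = 1` and `ε = -1`. -/
def nullNormal (ε : ℝ) (a b : L4) : L4 := timeNormal a b + ε • cross a b (timeNormal a b)

theorem IsOrthonormalPair.lor_timeNormal_neg (hab : IsOrthonormalPair a b) :
    lor (timeNormal a b) (timeNormal a b) < 0 := by
  have htime : lor (Pi.single 0 1) (Pi.single 0 1) = -1 := by simp [lor]
  have hsq : lor (timeNormal a b) (timeNormal a b) =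
      -1 - lor (Pi.single 0 1) a ^ 2 - lor (Pi.single 0 1) b ^ 2 := by
    nth_rw 2 [timeNormal]
    rw [timeNormal, lor_perp_right_of_orthogonal (hab.lor_perp_fst _) (hab.lor_perp_snd _), perp,
      lor_sub_left, lor_sub_left, lor_smul_left, lor_smul_left, lor_comm a, lor_comm b, htime]
    ring
  rw [hsq]
  linarith [sq_nonneg (lor (Pi.single 0 1) a), sq_nonneg (lor (Pi.single 0 1) b)]

theorem IsOrthonormalPair.lor_nullNormal_fst (hab : IsOrthonormalPair a b) (ε : ℝ) :
    lor (nullNormal ε a b) a = 0 := by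
  simp only [nullNormal, lor_add_left, lor_smul_left, lor_cross_fst, timeNormal, hab.lor_perp_fst]
  ring

theorem IsOrthonormalPair.lor_nullNormal_snd (hab : IsOrthonormalPair a b) (ε : ℝ) :
    lor (nullNormal ε a b) b = 0 := by
  simp only [nullNormal, lor_add_left, lor_smul_left, lor_cross_snd, timeNormal, hab.lor_perp_snd]
  ring

theorem IsOrthonormalPair.lor_nullNormal_self (hab : IsOrthonormalPair a b) {ε : ℝ}
    (hε : ε ^ 2 = 1) : lor (nullNormal ε a b) (nullNormal ε a b) = 0 := by
  have hTa : lor (timeNormal a b) a = 0 := hab.lor_perp_fst _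
  have hTb : lor (timeNormal a b) b = 0 := hab.lor_perp_snd _
  simp only [nullNormal, lor_add_left, lor_add_right, lor_smul_left, lor_smul_right,
    lor_cross_trd, lor_comm (timeNormal a b) (cross a b _), hab.lor_cross_cross hTa hTb]
  linear_combination -lor (timeNormal a b) (timeNormal a b) * hε

theorem IsOrthonormalPair.exists_lor_nullNormal_ne_zero (hab : IsOrthonormalPair a b)
    (ha : lor x a = 0) (hb : lor x b = 0) (hx : x ≠ 0) :
    ∃ ε : ℝ, ε ^ 2 = 1 ∧ lor (nullNormal ε a b) x ≠ 0 := by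
  by_contra! h
  have hplus := h 1 (by norm_num)
  have hminus := h (-1) (by norm_num)
  simp only [nullNormal, lor_add_left, lor_smul_left] at hplus hminus
  have hTa : lor (timeNormal a b) a = 0 := hab.lor_perp_fst _
  have hTb : lor (timeNormal a b) b = 0 := hab.lor_perp_snd _
  refine hx (hab.eq_zero_of_orthogonal_normal_basis hTa hTb (lor_cross_fst a b _)
    (lor_cross_snd a b _) ?_ ha hb (m := cross a b (timeNormal a b)) ?_ ?_)
  · rw [hab.lor_cross_cross hTa hTb, lor_comm _ (cross a b _), lor_cross_trd]
    have := hab.lor_timeNormal_neg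
    nlinarith
  all_goals
    rw [lor_comm]
    linarith

theorem abs_lor_le (a b : L4) : |lor a b| ≤ 4 * ‖a‖ * ‖b‖ := by
  have h : ∀ i, |a i * b i| ≤ ‖a‖ * ‖b‖ := fun i => by
    rw [abs_mul]
    exact mul_le_mul (norm_le_pi_norm a i) (norm_le_pi_norm b i) (abs_nonneg _) (norm_nonneg _)
  have h0 := abs_le.1 (h 0)
  have h1 := abs_le.1 (h 1)
  have h2 := abs_le.1 (h 2)
  have h3 := abs_le.1 (h 3)
  unfold lor
  exact abs_le.2 ⟨by linarith, by linarith⟩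

end LorentzianAlgebra

section LorentzianCalculus

variable {E : Type*} [NormedAddCommGroup E] [NormedSpace ℝ E] {F G : E → L4} {X : E → E}
  {Ω : Set E} {x : E}

theorem contDiff_lor : ContDiff ℝ ∞ fun p : L4 × L4 => lor p.1 p.2 := by
  unfold lor
  fun_prop

theorem contDiffOn_lor (hF : ContDiffOn ℝ ∞ F Ω) (hG : ContDiffOn ℝ ∞ G Ω) :
    ContDiffOn ℝ ∞ (fun y => lor (F y) (G y)) Ω :=
  contDiff_lor.comp_contDiffOn (hF.prodMk hG)

theorem differentiableAt_lor (hF : DifferentiableAt ℝ F x) (hG : DifferentiableAt ℝ G x) :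
    DifferentiableAt ℝ (fun y => lor (F y) (G y)) x :=
  (contDiff_lor.differentiable (by simp) _).comp x (hF.prodMk hG)

theorem fderiv_lor_apply (hF : DifferentiableAt ℝ F x) (hG : DifferentiableAt ℝ G x) (v : E) :
    fderiv ℝ (fun y => lor (F y) (G y)) x v =
      lor (fderiv ℝ F x v) (G x) + lor (F x) (fderiv ℝ G x v) := by
  have h : HasFDerivAt (fun y => lor (F y) (G y)) _ x :=
    lorForm.toContinuousBilinearMap.hasFDerivAt_of_bilinear hF.hasFDerivAt hG.hasFDerivAt
  rw [h.fderiv, add_comm]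
  rfl

theorem dirDeriv_lor (hF : DifferentiableAt ℝ F x) (hG : DifferentiableAt ℝ G x) :
    dirDeriv X (fun y => lor (F y) (G y)) x =
      lor (dirDeriv X F x) (G x) + lor (F x) (dirDeriv X G x) :=
  fderiv_lor_apply hF hG _

theorem contDiffOn_perp {A B C : E → L4} (hA : ContDiffOn ℝ ∞ A Ω) (hB : ContDiffOn ℝ ∞ B Ω)
    (hC : ContDiffOn ℝ ∞ C Ω) : ContDiffOn ℝ ∞ (fun y => perp (A y) (B y) (C y)) Ω :=
  (hC.sub ((contDiffOn_lor hC hA).smul hA)).sub ((contDiffOn_lor hC hB).smul hB)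

theorem contDiffOn_cross {A B C : E → L4} (hA : ContDiffOn ℝ ∞ A Ω) (hB : ContDiffOn ℝ ∞ B Ω)
    (hC : ContDiffOn ℝ ∞ C Ω) : ContDiffOn ℝ ∞ (fun y => cross (A y) (B y) (C y)) Ω := by
  rw [contDiffOn_pi] at hA hB hC ⊢
  intro i
  fin_cases i <;> simp only [cross, Matrix.cons_val, Fin.isValue, Fin.zero_eta, Fin.mk_one,
    Fin.reduceFinMk] <;> fun_prop

theorem contDiffOn_nullNormal {A B : E → L4} (hA : ContDiffOn ℝ ∞ A Ω) (hB : ContDiffOn ℝ ∞ B Ω)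
    (ε : ℝ) : ContDiffOn ℝ ∞ (fun y => nullNormal ε (A y) (B y)) Ω := by
  have hT : ContDiffOn ℝ ∞ (fun y => timeNormal (A y) (B y)) Ω :=
    contDiffOn_perp hA hB contDiffOn_const
  exact hT.add ((contDiffOn_cross hA hB hT).const_smul ε)

theorem lor_fderiv_add_lor_fderiv_eq_zero (hF : DifferentiableAt ℝ F x)
    (hG : DifferentiableAt ℝ G x) {c : ℝ} (h : ∀ᶠ y in 𝓝 x, lor (F y) (G y) = c) (v : E) :
    lor (fderiv ℝ F x v) (G x) + lor (F x) (fderiv ℝ G x v) = 0 := by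
  rw [← fderiv_lor_apply hF hG, EventuallyEq.fderiv_eq h, fderiv_fun_const]
  rfl

end LorentzianCalculus

section FramedSurfaces

variable {E : Type*} [NormedAddCommGroup E] [NormedSpace ℝ E] {f W : E → L4}
  {X Y : E → E} {Ω U : Set E} {x : E}

/-- A spacelike surface `f` in `L4` parametrized by `Ω`, with a frame `X`, `Y` which is orthonormal
in the induced metric. -/
structure IsFramedSurface (Ω : Set E) (f : E → L4) (X Y : E → E) : Prop where
  isOpen : IsOpen Ω
  contDiffOn : ContDiffOn ℝ ∞ f Ω
  contDiffOn_fst : ContDiffOn ℝ ∞ X Ω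
  contDiffOn_snd : ContDiffOn ℝ ∞ Y Ω
  spans : ∀ x ∈ Ω, ∀ v, ∃ s t : ℝ, v = s • X x + t • Y x
  orthonormal : ∀ x ∈ Ω, IsOrthonormalPair (dirDeriv X f x) (dirDeriv Y f x)

/-- `n` is orthogonal to the surface `f` at `x`. -/
def IsNormalVector (f : E → L4) (x : E) (n : L4) : Prop :=
  ∀ v, lor n (fderiv ℝ f x v) = 0

/-- The connection form `⟨∇_Z X, Y⟩` of the frame `X`, `Y`. -/
noncomputable def connForm (f : E → L4) (X Y Z : E → E) (x : E) : ℝ :=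
  lor (dirDeriv Z (dirDeriv X f) x) (dirDeriv Y f x)

namespace IsFramedSurface

theorem mono (hf : IsFramedSurface Ω f X Y) (hU : IsOpen U) (hUΩ : U ⊆ Ω) :
    IsFramedSurface U f X Y where
  isOpen := hU
  contDiffOn := hf.contDiffOn.mono hUΩ
  contDiffOn_fst := hf.contDiffOn_fst.mono hUΩ
  contDiffOn_snd := hf.contDiffOn_snd.mono hUΩ
  spans x hx := hf.spans x (hUΩ hx)
  orthonormal x hx := hf.orthonormal x (hUΩ hx)

theorem contDiffOn_dirDeriv_fst (hf : IsFramedSurface Ω f X Y) (hW : ContDiffOn ℝ ∞ W Ω) :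
    ContDiffOn ℝ ∞ (dirDeriv X W) Ω :=
  contDiffOn_dirDeriv hf.contDiffOn_fst hW hf.isOpen

theorem contDiffOn_dirDeriv_snd (hf : IsFramedSurface Ω f X Y) (hW : ContDiffOn ℝ ∞ W Ω) :
    ContDiffOn ℝ ∞ (dirDeriv Y W) Ω :=
  contDiffOn_dirDeriv hf.contDiffOn_snd hW hf.isOpen

theorem differentiableAt (hf : IsFramedSurface Ω f X Y) {V : Type*} [NormedAddCommGroup V]
    [NormedSpace ℝ V] {g : E → V} (hg : ContDiffOn ℝ ∞ g Ω) (hx : x ∈ Ω) :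
    DifferentiableAt ℝ g x :=
  differentiableAt_of_contDiffOn hg hf.isOpen hx

theorem isNormalVector_iff (hf : IsFramedSurface Ω f X Y) (hx : x ∈ Ω) {n : L4} :
    IsNormalVector f x n ↔ lor n (dirDeriv X f x) = 0 ∧ lor n (dirDeriv Y f x) = 0 := by
  refine ⟨fun h => ⟨h _, h _⟩, fun ⟨hX, hY⟩ v => ?_⟩
  obtain ⟨s, t, rfl⟩ := hf.spans x hx v
  rw [map_add, map_smul, map_smul, lor_add_right, lor_smul_right, lor_smul_right]
  change s * lor n (dirDeriv X f x) + t * lor n (dirDeriv Y f x) = 0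
  rw [hX, hY, mul_zero, mul_zero, add_zero]

theorem contDiffOn_connForm (hf : IsFramedSurface Ω f X Y) {Z : E → E} (hZ : ContDiffOn ℝ ∞ Z Ω) :
    ContDiffOn ℝ ∞ (connForm f X Y Z) Ω :=
  contDiffOn_lor (contDiffOn_dirDeriv hZ (hf.contDiffOn_dirDeriv_fst hf.contDiffOn) hf.isOpen)
    (hf.contDiffOn_dirDeriv_snd hf.contDiffOn)

section

variable (hf : IsFramedSurface Ω f X Y) (hx : x ∈ Ω) (Z : E → E)
include hf hx

theorem lor_dirDeriv_fst_fst : lor (dirDeriv Z (dirDeriv X f) x) (dirDeriv X f x) = 0 := by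
  have he := hf.differentiableAt (hf.contDiffOn_dirDeriv_fst hf.contDiffOn) hx
  have h := lor_fderiv_add_lor_fderiv_eq_zero he he (c := 1) (by
    filter_upwards [hf.isOpen.mem_nhds hx] with y hy using (hf.orthonormal y hy).fst) (Z x)
  rw [lor_comm _ (fderiv ℝ _ x _)] at h
  unfold dirDeriv at h ⊢
  linarith

theorem lor_dirDeriv_snd_snd : lor (dirDeriv Z (dirDeriv Y f) x) (dirDeriv Y f x) = 0 := by
  have he := hf.differentiableAt (hf.contDiffOn_dirDeriv_snd hf.contDiffOn) hx
  have h := lor_fderiv_add_lor_fderiv_eq_zero he he (c := 1) (by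
    filter_upwards [hf.isOpen.mem_nhds hx] with y hy using (hf.orthonormal y hy).snd) (Z x)
  rw [lor_comm _ (fderiv ℝ _ x _)] at h
  unfold dirDeriv at h ⊢
  linarith

theorem lor_dirDeriv_snd_fst :
    lor (dirDeriv Z (dirDeriv Y f) x) (dirDeriv X f x) = -connForm f X Y Z x := by
  have h := lor_fderiv_add_lor_fderiv_eq_zero
    (hf.differentiableAt (hf.contDiffOn_dirDeriv_fst hf.contDiffOn) hx)
    (hf.differentiableAt (hf.contDiffOn_dirDeriv_snd hf.contDiffOn) hx) (c := 0) (by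
      filter_upwards [hf.isOpen.mem_nhds hx] with y hy using (hf.orthonormal y hy).fst_snd) (Z x)
  rw [lor_comm (dirDeriv X f x)] at h
  exact eq_neg_of_add_eq_zero_right h

end

theorem isMovingFrame (hf : IsFramedSurface Ω f X Y) :
    IsMovingFrame Ω X Y (-connForm f X Y X) (-connForm f X Y Y) where
  isOpen := hf.isOpen
  contDiffOn_fst := hf.contDiffOn_fst
  contDiffOn_snd := hf.contDiffOn_snd
  contDiffOn_fst_coeff := (hf.contDiffOn_connForm hf.contDiffOn_fst).neg
  contDiffOn_snd_coeff := (hf.contDiffOn_connForm hf.contDiffOn_snd).neg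
  spans := hf.spans
  lieBracket_eq x hx := by
    obtain ⟨s, t, hst⟩ := hf.spans x hx (lieBracket ℝ X Y x)
    have hcomm := dirDeriv_commutator (hf.differentiableAt hf.contDiffOn_fst hx)
      (hf.differentiableAt hf.contDiffOn_snd hx)
      ((hf.contDiffOn.contDiffAt (hf.isOpen.mem_nhds hx)).of_le (by norm_cast))
    rw [hst, map_add, map_smul, map_smul] at hcomm
    change _ = s • dirDeriv X f x + t • dirDeriv Y f x at hcomm
    have hs := congrArg (lor · (dirDeriv X f x)) hcomm
    have ht := congrArg (lor · (dirDeriv Y f x)) hcomm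
    have he := hf.orthonormal x hx
    simp only [lor_sub_left, lor_add_left, lor_smul_left, he.fst, he.snd, he.fst_snd,
      he.lor_snd_fst, hf.lor_dirDeriv_fst_fst hx, hf.lor_dirDeriv_snd_snd hx,
      hf.lor_dirDeriv_snd_fst hx] at hs ht
    rw [hst]
    congr 2
    · rw [Pi.neg_apply]
      linarith
    · rw [Pi.neg_apply, connForm]
      linarith

theorem dirDeriv_dirDeriv_sub (hf : IsFramedSurface Ω f X Y) (hW : ContDiffOn ℝ ∞ W Ω)
    (hx : x ∈ Ω) :
    dirDeriv X (dirDeriv Y W) x - dirDeriv Y (dirDeriv X W) x =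
      -(connForm f X Y X x • dirDeriv X W x + connForm f X Y Y x • dirDeriv Y W x) := by
  rw [dirDeriv_commutator (hf.differentiableAt hf.contDiffOn_fst hx)
    (hf.differentiableAt hf.contDiffOn_snd hx)
    ((hW.contDiffAt (hf.isOpen.mem_nhds hx)).of_le (by norm_cast)),
    hf.isMovingFrame.lieBracket_eq x hx, map_add, map_smul, map_smul, Pi.neg_apply, Pi.neg_apply,
    neg_smul, neg_smul, ← neg_add]
  rfl

end IsFramedSurface

end FramedSurfaces

section TracelessFields

variable {E : Type*} [NormedAddCommGroup E] [NormedSpace ℝ E] {f W W₁ W₂ : E → L4}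
  {X Y : E → E} {Ω : Set E} {x : E}

/-- The derivative of `W` is the composition of `df` with a symmetric and trace-free endomorphism of
the tangent spaces. -/
structure IsTracelessField (Ω : Set E) (f : E → L4) (X Y : E → E) (W : E → L4) : Prop where
  contDiffOn : ContDiffOn ℝ ∞ W Ω
  dirDeriv_eq : ∀ x ∈ Ω, ∃ p q : ℝ, dirDeriv X W x = p • dirDeriv X f x + q • dirDeriv Y f x ∧
    dirDeriv Y W x = q • dirDeriv X f x - p • dirDeriv Y f x

/-- The Hopf function `⟨X W, X⟩ - i ⟨X W, Y⟩` of a traceless field `W`. -/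
noncomputable def hopf (f : E → L4) (X Y : E → E) (W : E → L4) (x : E) : ℂ :=
  ⟨lor (dirDeriv X W x) (dirDeriv X f x), -lor (dirDeriv X W x) (dirDeriv Y f x)⟩

theorem hopf_add_const_smul (h₁ : DifferentiableAt ℝ W₁ x) (h₂ : DifferentiableAt ℝ W₂ x) (c : ℝ) :
    hopf f X Y (fun y => W₁ y + c • W₂ y) x = hopf f X Y W₁ x + c * hopf f X Y W₂ x := by
  apply Complex.ext
  · simp [hopf, dirDeriv_add_const_smul h₁ h₂, lor_add_left, lor_smul_left]
  · simp [hopf, dirDeriv_add_const_smul h₁ h₂, lor_add_left, lor_smul_left]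
    ring

theorem IsFramedSurface.hopf_self (hf : IsFramedSurface Ω f X Y) (hx : x ∈ Ω) :
    hopf f X Y f x = 1 := by
  have he := hf.orthonormal x hx
  apply Complex.ext <;> simp [hopf, he.fst, he.fst_snd]

theorem IsFramedSurface.hopf_of_dirDeriv_fst (hf : IsFramedSurface Ω f X Y) (hx : x ∈ Ω) {p q : ℝ}
    (hW : dirDeriv X W x = p • dirDeriv X f x + q • dirDeriv Y f x) :
    hopf f X Y W x = ⟨p, -q⟩ := by
  have he := hf.orthonormal x hx
  simp [hopf, hW, lor_add_left, lor_smul_left, he.fst, he.snd, he.fst_snd, he.lor_snd_fst]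

namespace IsTracelessField

variable (hf : IsFramedSurface Ω f X Y)
include hf

theorem dirDeriv_fst_eq (hW : IsTracelessField Ω f X Y W) (hx : x ∈ Ω) :
    dirDeriv X W x =
      (hopf f X Y W x).re • dirDeriv X f x - (hopf f X Y W x).im • dirDeriv Y f x := by
  obtain ⟨p, q, hXW, -⟩ := hW.dirDeriv_eq x hx
  rw [hf.hopf_of_dirDeriv_fst hx hXW, hXW, neg_smul, sub_neg_eq_add]

theorem dirDeriv_snd_eq (hW : IsTracelessField Ω f X Y W) (hx : x ∈ Ω) :
    dirDeriv Y W x =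
      -((hopf f X Y W x).im • dirDeriv X f x + (hopf f X Y W x).re • dirDeriv Y f x) := by
  obtain ⟨p, q, hXW, hYW⟩ := hW.dirDeriv_eq x hx
  rw [hf.hopf_of_dirDeriv_fst hx hXW, hYW, neg_smul]
  abel

theorem hopf_eq_zero_iff (hW : IsTracelessField Ω f X Y W) (hx : x ∈ Ω) :
    hopf f X Y W x = 0 ↔ fderiv ℝ W x = 0 := by
  rw [hf.isMovingFrame.fderiv_eq_zero_iff hx]
  refine ⟨fun h => ?_, fun h => ?_⟩
  · rw [hW.dirDeriv_fst_eq hf hx, hW.dirDeriv_snd_eq hf hx, h]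
    simp
  · simp [hopf, h.1, lor_zero_left, Complex.ext_iff]

theorem contDiffOn_hopf (hW : ContDiffOn ℝ ∞ W Ω) : ContDiffOn ℝ ∞ (hopf f X Y W) Ω := by
  have hXW := hf.contDiffOn_dirDeriv_fst hW
  have hre := contDiffOn_lor hXW (hf.contDiffOn_dirDeriv_fst hf.contDiffOn)
  have him := (contDiffOn_lor hXW (hf.contDiffOn_dirDeriv_snd hf.contDiffOn)).neg
  exact Complex.equivRealProdCLM.symm.contDiff.comp_contDiffOn (hre.prodMk him)

theorem hopf_eq_of_dirDeriv_snd (hW : IsTracelessField Ω f X Y W) (hx : x ∈ Ω) :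
    hopf f X Y W x =
      ⟨-lor (dirDeriv Y W x) (dirDeriv Y f x), -lor (dirDeriv Y W x) (dirDeriv X f x)⟩ := by
  have he := hf.orthonormal x hx
  rw [hW.dirDeriv_snd_eq hf hx]
  simp [lor_neg_left, lor_add_left, lor_smul_left, he.fst, he.snd, he.fst_snd, he.lor_snd_fst]

/-- The `X`-derivative is taken of the expression in `Y W` and the `Y`-derivative of the one in
`X W`, so that only the commutator of the two second derivatives of `W` occurs. -/
theorem dirDeriv_hopf (hW : IsTracelessField Ω f X Y W) (hx : x ∈ Ω) :
    dirDeriv X (hopf f X Y W) x + Complex.I * dirDeriv Y (hopf f X Y W) x =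
      2 * Complex.I * ⟨connForm f X Y X x, connForm f X Y Y x⟩ * hopf f X Y W x := by
  have hX := hf.differentiableAt (hf.contDiffOn_dirDeriv_fst hf.contDiffOn) hx
  have hY := hf.differentiableAt (hf.contDiffOn_dirDeriv_snd hf.contDiffOn) hx
  have hXW := hf.differentiableAt (hf.contDiffOn_dirDeriv_fst hW.contDiffOn) hx
  have hYW := hf.differentiableAt (hf.contDiffOn_dirDeriv_snd hW.contDiffOn) hx
  have hsnd : hopf f X Y W =ᶠ[𝓝 x] fun y =>
      ⟨-lor (dirDeriv Y W y) (dirDeriv Y f y), -lor (dirDeriv Y W y) (dirDeriv X f y)⟩ := by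
    filter_upwards [hf.isOpen.mem_nhds hx] with y hy using hW.hopf_eq_of_dirDeriv_snd hf hy
  have hXh : dirDeriv X (hopf f X Y W) x = _ := (dirDeriv_eventuallyEq hsnd).eq_of_nhds
  have hYh : dirDeriv Y (hopf f X Y W) x = _ := dirDeriv_complex_mk
    (differentiableAt_lor hXW hX) (differentiableAt_lor hXW hY).fun_neg
  rw [dirDeriv_complex_mk (differentiableAt_lor hYW hY).fun_neg
    (differentiableAt_lor hYW hX).fun_neg, dirDeriv_neg, dirDeriv_neg, dirDeriv_lor hYW hY,
    dirDeriv_lor hYW hX] at hXh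
  rw [dirDeriv_neg, dirDeriv_lor hXW hX, dirDeriv_lor hXW hY] at hYh
  have hcomm := hf.dirDeriv_dirDeriv_sub hW.contDiffOn hx
  have hfst := congrArg (lor · (dirDeriv X f x)) hcomm
  have hsnd := congrArg (lor · (dirDeriv Y f x)) hcomm
  have he := hf.orthonormal x hx
  have hXX := hf.lor_dirDeriv_fst_fst hx
  have hYY := hf.lor_dirDeriv_snd_snd hx
  have hYX := hf.lor_dirDeriv_snd_fst hx
  have hXY : ∀ Z, lor (dirDeriv Z (dirDeriv X f) x) (dirDeriv Y f x) = connForm f X Y Z x :=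
    fun _ => rfl
  simp only [hW.dirDeriv_fst_eq hf hx, hW.dirDeriv_snd_eq hf hx, lor_sub_left, lor_neg_left,
    lor_add_left, lor_smul_left, he.fst, he.snd, he.fst_snd, he.lor_snd_fst,
    lor_comm (dirDeriv _ f x) (dirDeriv _ (dirDeriv _ f) x), hXX, hYY, hYX, hXY]
    at hfst hsnd hXh hYh
  rw [hXh, hYh]
  apply Complex.ext <;> simp <;> linarith

theorem isCauchyRiemannSolution (hW : IsTracelessField Ω f X Y W) :
    IsCauchyRiemannSolution Ω X Y
      (fun x => 2 * Complex.I * ⟨connForm f X Y X x, connForm f X Y Y x⟩) (hopf f X Y W) where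
  contDiffOn_coeff := contDiffOn_const.mul (Complex.equivRealProdCLM.symm.contDiff.comp_contDiffOn
    ((hf.contDiffOn_connForm hf.contDiffOn_fst).prodMk (hf.contDiffOn_connForm hf.contDiffOn_snd)))
  contDiffOn := contDiffOn_hopf hf hW.contDiffOn
  eq _ hx := hW.dirDeriv_hopf hf hx

end IsTracelessField

end TracelessFields

section RealRatio

variable {E : Type*} [NormedAddCommGroup E] [NormedSpace ℝ E] {X Y : E → E} {α β : E → ℝ}
  {Ω : Set E} {a w₁ w₂ : E → ℂ} {x : E}

/-- The ratio `r` of the solutions satisfies `(X + iY)r = 0`, hence `Xr = Yr = 0` as `r` is real. -/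
theorem IsCauchyRiemannSolution.eventually_eq_real_mul (hw₁ : IsCauchyRiemannSolution Ω X Y a w₁)
    (hw₂ : IsCauchyRiemannSolution Ω X Y a w₂) (hXY : IsMovingFrame Ω X Y α β)
    (hreal : ∀ x ∈ Ω, (w₁ x / w₂ x).im = 0) (hx : x ∈ Ω) (hne : w₂ x ≠ 0) :
    ∃ c : ℝ, ∀ᶠ y in 𝓝 x, w₁ y = c * w₂ y := by
  set r : E → ℝ := fun y => (w₁ y / w₂ y).re
  have hΩ := hXY.isOpen
  have hd₁ : ∀ y ∈ Ω, DifferentiableAt ℝ w₁ y := fun y hy =>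
    differentiableAt_of_contDiffOn hw₁.contDiffOn hΩ hy
  have hd₂ : ∀ y ∈ Ω, DifferentiableAt ℝ w₂ y := fun y hy =>
    differentiableAt_of_contDiffOn hw₂.contDiffOn hΩ hy
  have hnear : ∀ᶠ y in 𝓝 x, y ∈ Ω ∧ w₂ y ≠ 0 :=
    (hΩ.eventually_mem hx).and ((hd₂ x hx).continuousAt.eventually_ne hne)
  have hmul : ∀ᶠ y in 𝓝 x, w₁ y = r y * w₂ y := hnear.mono fun y ⟨hy, hy₀⟩ => by
    rw [show (r y : ℂ) = w₁ y / w₂ y from Complex.ext rfl (hreal y hy).symm, div_mul_cancel₀ _ hy₀]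
  have hr : ∀ᶠ y in 𝓝 x, DifferentiableAt ℝ r y := hnear.mono fun y ⟨hy, hy₀⟩ =>
    Complex.reCLM.differentiableAt.comp y <|
      ((hd₁ y hy).mul ((hd₂ y hy).inv hy₀)).congr_of_eventuallyEq
        (.of_forall fun z => div_eq_mul_inv _ _)
  have hdr : ∀ᶠ y in 𝓝 x, fderiv ℝ r y = 0 := by
    filter_upwards [hnear, hmul.eventually_nhds, hr] with y ⟨hy, hy₀⟩ hmuly hry
    have hrc : DifferentiableAt ℝ (fun z => (r z : ℂ)) y :=
      Complex.ofRealCLM.differentiableAt.comp y hry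
    have hdir : ∀ Z : E → E, dirDeriv Z w₁ y = dirDeriv Z r y * w₂ y + r y * dirDeriv Z w₂ y :=
      fun Z => by
        rw [(dirDeriv_eventuallyEq hmuly).eq_of_nhds, dirDeriv_mul hrc (hd₂ y hy)]
        exact congrArg (· * w₂ y + _) (dirDeriv_clm_comp Complex.ofRealCLM hry)
    have hprod : (((dirDeriv X r y : ℝ) : ℂ) + Complex.I * (dirDeriv Y r y : ℝ)) * w₂ y = 0 := by
      have h₁ := hw₁.eq y hy
      rw [hdir, hdir, hmuly.self_of_nhds] at h₁
      linear_combination h₁ - r y * hw₂.eq y hy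
    have hzero := (mul_eq_zero.1 hprod).resolve_right hy₀
    rw [hXY.fderiv_eq_zero_iff hy]
    exact ⟨by simpa using congrArg Complex.re hzero, by simpa using congrArg Complex.im hzero⟩
  refine ⟨r x, ?_⟩
  filter_upwards [hmul, eventually_eq_of_eventually_fderiv_eq_zero hr hdr] with y hy hry
  rw [hy, hry]

end RealRatio

section ParallelFields

variable {E : Type*} [NormedAddCommGroup E] [NormedSpace ℝ E] {f ξ η H : E → L4}
  {X Y : E → E} {Ω U : Set E} {c d : ℝ} {x : E}

/-- `ξ` is a section of the normal bundle of `f` which is parallel in the normal connection: its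
derivatives are tangent to the surface. -/
structure IsParallelField (Ω : Set E) (f ξ : E → L4) : Prop where
  contDiffOn : ContDiffOn ℝ ∞ ξ Ω
  normal : ∀ x ∈ Ω, IsNormalVector f x (ξ x)
  parallel : ∀ x ∈ Ω, ∀ v, ∃ u, fderiv ℝ ξ x v = fderiv ℝ f x u

namespace IsParallelField

theorem mono (hξ : IsParallelField Ω f ξ) (hUΩ : U ⊆ Ω) : IsParallelField U f ξ where
  contDiffOn := hξ.contDiffOn.mono hUΩ
  normal x hx := hξ.normal x (hUΩ hx)
  parallel x hx := hξ.parallel x (hUΩ hx)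

theorem lor_fderiv_eq_zero (hξ : IsParallelField Ω f ξ) (hx : x ∈ Ω) (v : E) {n : L4}
    (hn : IsNormalVector f x n) : lor (fderiv ℝ ξ x v) n = 0 := by
  obtain ⟨u, hu⟩ := hξ.parallel x hx v
  rw [hu, lor_comm, hn u]

theorem fderiv_lor_eq_zero (hξ : IsParallelField Ω f ξ) (hη : IsParallelField Ω f η)
    (hΩ : IsOpen Ω) (hx : x ∈ Ω) : fderiv ℝ (fun y => lor (ξ y) (η y)) x = 0 := by
  ext v
  rw [fderiv_lor_apply (differentiableAt_of_contDiffOn hξ.contDiffOn hΩ hx)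
    (differentiableAt_of_contDiffOn hη.contDiffOn hΩ hx),
    hξ.lor_fderiv_eq_zero hx v (hη.normal x hx), lor_comm,
    hη.lor_fderiv_eq_zero hx v (hξ.normal x hx), add_zero]
  rfl

theorem exists_lor_eq (hξ : IsParallelField Ω f ξ) (hη : IsParallelField Ω f η) (hΩ : IsOpen Ω)
    (hΩ' : IsPreconnected Ω) : ∃ c, ∀ x ∈ Ω, lor (ξ x) (η x) = c :=
  hΩ.exists_is_const_of_fderiv_eq_zero hΩ'
    (fun _ hx => (differentiableAt_of_contDiffOn (contDiffOn_lor hξ.contDiffOn hη.contDiffOn) hΩ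
      hx).differentiableWithinAt) fun _ hx => hξ.fderiv_lor_eq_zero hη hΩ hx

theorem add (hξ : IsParallelField Ω f ξ) (hη : IsParallelField Ω f η) (hΩ : IsOpen Ω) :
    IsParallelField Ω f (fun x => ξ x + η x) where
  contDiffOn := hξ.contDiffOn.add hη.contDiffOn
  normal x hx v := by rw [lor_add_left, hξ.normal x hx, hη.normal x hx, add_zero]
  parallel x hx v := by
    obtain ⟨u, hu⟩ := hξ.parallel x hx v
    obtain ⟨w, hw⟩ := hη.parallel x hx v
    refine ⟨u + w, ?_⟩
    rw [fderiv_fun_add (differentiableAt_of_contDiffOn hξ.contDiffOn hΩ hx)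
      (differentiableAt_of_contDiffOn hη.contDiffOn hΩ hx), add_apply, hu, hw, map_add]

theorem const_smul (hξ : IsParallelField Ω f ξ) (hΩ : IsOpen Ω) (c : ℝ) :
    IsParallelField Ω f (fun x => c • ξ x) where
  contDiffOn := hξ.contDiffOn.const_smul c
  normal x hx v := by rw [lor_smul_left, hξ.normal x hx, mul_zero]
  parallel x hx v := by
    obtain ⟨u, hu⟩ := hξ.parallel x hx v
    refine ⟨c • u, ?_⟩
    rw [fderiv_fun_const_smul (differentiableAt_of_contDiffOn hξ.contDiffOn hΩ hx), smul_apply, hu,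
      map_smul]

variable (hf : IsFramedSurface Ω f X Y)
include hf

theorem lor_dirDeriv_dirDeriv (hξ : IsParallelField Ω f ξ) (hx : x ∈ Ω) {V Z : E → E}
    (hV : ContDiffOn ℝ ∞ V Ω) :
    lor (dirDeriv Z ξ x) (dirDeriv V f x) = -lor (dirDeriv Z (dirDeriv V f) x) (ξ x) := by
  have h := lor_fderiv_add_lor_fderiv_eq_zero (hf.differentiableAt hξ.contDiffOn hx)
    (hf.differentiableAt (contDiffOn_dirDeriv hV hf.contDiffOn hf.isOpen) hx) (c := 0)
    (by filter_upwards [hf.isOpen.mem_nhds hx] with y hy using hξ.normal y hy _) (Z x)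
  rw [lor_comm (ξ x)] at h
  exact eq_neg_of_add_eq_zero_left h

theorem lor_dirDeriv_fst_snd_comm (hξ : IsParallelField Ω f ξ) (hx : x ∈ Ω) :
    lor (dirDeriv X ξ x) (dirDeriv Y f x) = lor (dirDeriv Y ξ x) (dirDeriv X f x) := by
  have hcomm := congrArg (lor · (ξ x)) (hf.dirDeriv_dirDeriv_sub hf.contDiffOn hx)
  have hnormal := (hf.isNormalVector_iff hx).1 (hξ.normal x hx)
  simp only [lor_sub_left, lor_neg_left, lor_add_left, lor_smul_left, lor_comm (dirDeriv _ f x),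
    hnormal] at hcomm
  rw [hξ.lor_dirDeriv_dirDeriv hf hx hf.contDiffOn_snd, hξ.lor_dirDeriv_dirDeriv hf hx
    hf.contDiffOn_fst]
  linear_combination -hcomm

/-- The Ricci equation: the shape operators of parallel fields commute. -/
theorem lor_dirDeriv_dirDeriv_comm (hξ : IsParallelField Ω f ξ) (hη : IsParallelField Ω f η)
    (hx : x ∈ Ω) :
    lor (dirDeriv X ξ x) (dirDeriv Y η x) = lor (dirDeriv Y ξ x) (dirDeriv X η x) := by
  have horth {Z V : E → E} (hZ : ContDiffOn ℝ ∞ Z Ω) :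
      lor (dirDeriv V (dirDeriv Z ξ) x) (η x) + lor (dirDeriv Z ξ x) (dirDeriv V η x) = 0 :=
    lor_fderiv_add_lor_fderiv_eq_zero
      (hf.differentiableAt (contDiffOn_dirDeriv hZ hξ.contDiffOn hf.isOpen) hx)
      (hf.differentiableAt hη.contDiffOn hx)
      (by filter_upwards [hf.isOpen.mem_nhds hx] with y hy using
        hξ.lor_fderiv_eq_zero hy _ (hη.normal y hy)) (V x)
  have hcomm := congrArg (lor · (η x)) (hf.dirDeriv_dirDeriv_sub hξ.contDiffOn hx)
  simp only [lor_sub_left, lor_neg_left, lor_add_left, lor_smul_left] at hcomm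
  have hX : lor (dirDeriv X ξ x) (η x) = 0 := hξ.lor_fderiv_eq_zero hx _ (hη.normal x hx)
  have hY : lor (dirDeriv Y ξ x) (η x) = 0 := hξ.lor_fderiv_eq_zero hx _ (hη.normal x hx)
  linear_combination horth hf.contDiffOn_fst (V := Y) - horth hf.contDiffOn_snd (V := X) + hcomm -
    connForm f X Y X x * hX - connForm f X Y Y x * hY

theorem dirDeriv_eq (hξ : IsParallelField Ω f ξ) (hx : x ∈ Ω) (Z : E → E) :
    dirDeriv Z ξ x = lor (dirDeriv Z ξ x) (dirDeriv X f x) • dirDeriv X f x +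
      lor (dirDeriv Z ξ x) (dirDeriv Y f x) • dirDeriv Y f x :=
  (hf.orthonormal x hx).eq_of_orthogonal_normals fun _ hX hY =>
    hξ.lor_fderiv_eq_zero hx _ ((hf.isNormalVector_iff hx).2 ⟨hX, hY⟩)

end IsParallelField

theorem IsParallelField.eventually_eq_zero (hξ : IsParallelField Ω f ξ)
    (hf : IsFramedSurface Ω f X Y) (hx : x ∈ Ω) (h₀ : ξ x = 0) : ∀ᶠ y in 𝓝 x, ξ y = 0 := by
  set e₁ := dirDeriv X f
  set e₂ := dirDeriv Y f
  have he₁ := (hf.contDiffOn_dirDeriv_fst hf.contDiffOn).contDiffAt (hf.isOpen.mem_nhds hx)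
  have he₂ := (hf.contDiffOn_dirDeriv_snd hf.contDiffOn).contDiffAt (hf.isOpen.mem_nhds hx)
  set K : E → ℝ := fun y => 4 * ‖fderiv ℝ e₁ y‖ * ‖e₁ y‖ + 4 * ‖fderiv ℝ e₂ y‖ * ‖e₂ y‖
  have hK : ContinuousAt K x := by
    have h₁ := he₁.continuousAt.norm
    have h₂ := he₂.continuousAt.norm
    have h₁' := (he₁.continuousAt_fderiv (by simp)).norm
    have h₂' := (he₂.continuousAt_fderiv (by simp)).norm
    exact ((h₁'.const_mul 4).mul h₁).add ((h₂'.const_mul 4).mul h₂)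
  have hterm (e : E → L4) (y v : E) : ‖-lor (fderiv ℝ e y v) (ξ y) • e y‖ ≤
      4 * ‖fderiv ℝ e y‖ * ‖e y‖ * ‖ξ y‖ * ‖v‖ := by
    rw [norm_smul, Real.norm_eq_abs, abs_neg]
    calc |lor (fderiv ℝ e y v) (ξ y)| * ‖e y‖ ≤ 4 * ‖fderiv ℝ e y v‖ * ‖ξ y‖ * ‖e y‖ := by
          gcongr; exact abs_lor_le _ _
      _ ≤ 4 * (‖fderiv ℝ e y‖ * ‖v‖) * ‖ξ y‖ * ‖e y‖ := by
          gcongr; exact ContinuousLinearMap.le_opNorm _ _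
      _ = _ := by ring
  refine eventually_eq_zero_of_norm_fderiv_le (K := K x + 1) ?_ ?_ h₀
  · filter_upwards [hf.isOpen.mem_nhds hx] with y hy using hf.differentiableAt hξ.contDiffOn hy
  filter_upwards [hf.isOpen.mem_nhds hx, hK.eventually_le_const (lt_add_one (K x))] with y hy hKy
  refine ContinuousLinearMap.opNorm_le_bound _ (by positivity) fun v => ?_
  have hdξ := hξ.dirDeriv_eq hf hy fun _ => v
  rw [hξ.lor_dirDeriv_dirDeriv hf hy hf.contDiffOn_fst, hξ.lor_dirDeriv_dirDeriv hf hy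
    hf.contDiffOn_snd] at hdξ
  calc ‖fderiv ℝ ξ y v‖ ≤ K y * ‖ξ y‖ * ‖v‖ := by
        refine (congrArg norm hdξ).le.trans ((norm_add_le _ _).trans ?_)
        exact (add_le_add (hterm e₁ y v) (hterm e₂ y v)).trans_eq (by ring)
    _ ≤ (K x + 1) * ‖ξ y‖ * ‖v‖ := by gcongr

theorem IsParallelField.of_lor_eq_const (hf : IsFramedSurface Ω f X Y) (hH : IsParallelField Ω f H)
    (hξ : ContDiffOn ℝ ∞ ξ Ω) (hξn : ∀ x ∈ Ω, IsNormalVector f x (ξ x))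
    (hξξ : ∀ x ∈ Ω, lor (ξ x) (ξ x) = c) (hξH : ∀ x ∈ Ω, lor (ξ x) (H x) = d)
    (hne : ∀ x ∈ Ω, c * lor (H x) (H x) - d ^ 2 ≠ 0) : IsParallelField Ω f ξ where
  contDiffOn := hξ
  normal := hξn
  parallel x hx v := by
    have he := hf.orthonormal x hx
    have hξd := hf.differentiableAt hξ hx
    have hHd := hf.differentiableAt hH.contDiffOn hx
    have hξx := (hf.isNormalVector_iff hx).1 (hξn x hx)
    have hHx := (hf.isNormalVector_iff hx).1 (hH.normal x hx)
    have hξξ' := lor_fderiv_add_lor_fderiv_eq_zero hξd hξd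
      ((hf.isOpen.eventually_mem hx).mono hξξ) v
    have hξH' := lor_fderiv_add_lor_fderiv_eq_zero hξd hHd
      ((hf.isOpen.eventually_mem hx).mono hξH) v
    rw [lor_comm, ← two_mul, mul_eq_zero_iff_left two_ne_zero] at hξξ'
    rw [lor_comm (ξ x), hH.lor_fderiv_eq_zero hx v (hξn x hx), add_zero, lor_comm] at hξH'
    have hperp := he.eq_zero_of_orthogonal_normal_basis hξx.1 hξx.2 hHx.1 hHx.2
      (by rw [hξξ x hx, hξH x hx]; exact hne x hx) (he.lor_perp_fst _) (he.lor_perp_snd _)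
      (x := perp (dirDeriv X f x) (dirDeriv Y f x) (fderiv ℝ ξ x v))
      (by rw [lor_comm, lor_perp_right_of_orthogonal hξx.1 hξx.2, hξξ'])
      (by rw [lor_comm, lor_perp_right_of_orthogonal hHx.1 hHx.2, hξH'])
    refine ⟨lor (fderiv ℝ ξ x v) (dirDeriv X f x) • X x +
      lor (fderiv ℝ ξ x v) (dirDeriv Y f x) • Y x, ?_⟩
    rw [map_add, map_smul, map_smul]
    exact eq_of_perp_eq_zero hperp

theorem exists_null_parallelField (hf : IsFramedSurface Ω f X Y) (hH : IsParallelField Ω f H)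
    (hx : x ∈ Ω) (hHx : H x ≠ 0) :
    ∃ r > 0, ball x r ⊆ Ω ∧ ∃ ξ, IsParallelField (ball x r) f ξ ∧
      ∀ y ∈ ball x r, lor (ξ y) (ξ y) = 0 ∧ lor (ξ y) (H y) = 1 := by
  have hHn := (hf.isNormalVector_iff hx).1 (hH.normal x hx)
  obtain ⟨ε, hε, hne⟩ := (hf.orthonormal x hx).exists_lor_nullNormal_ne_zero hHn.1 hHn.2 hHx
  set N : E → L4 := fun y => nullNormal ε (dirDeriv X f y) (dirDeriv Y f y)
  have hN : ContDiffOn ℝ ∞ N Ω := contDiffOn_nullNormal (hf.contDiffOn_dirDeriv_fst hf.contDiffOn)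
    (hf.contDiffOn_dirDeriv_snd hf.contDiffOn) ε
  have hNH : ContDiffOn ℝ ∞ (fun y => lor (N y) (H y)) Ω := contDiffOn_lor hN hH.contDiffOn
  obtain ⟨r, hr, hball⟩ := Metric.eventually_nhds_iff_ball.1 ((hf.isOpen.eventually_mem hx).and
    ((hf.differentiableAt hNH hx).continuousAt.eventually_ne hne))
  have hsub : ball x r ⊆ Ω := fun y hy => (hball y hy).1
  set ξ : E → L4 := fun y => (lor (N y) (H y))⁻¹ • N y
  have hξ : ContDiffOn ℝ ∞ ξ (ball x r) :=
    ((hNH.mono hsub).inv fun y hy => (hball y hy).2).smul (hN.mono hsub)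
  have hnull : ∀ y ∈ ball x r, lor (ξ y) (ξ y) = 0 := fun y hy => by
    rw [lor_smul_left, lor_smul_right, (hf.orthonormal y (hsub hy)).lor_nullNormal_self hε,
      mul_zero, mul_zero]
  have hone : ∀ y ∈ ball x r, lor (ξ y) (H y) = 1 := fun y hy => by
    rw [lor_smul_left, inv_mul_cancel₀ (hball y hy).2]
  have hnormal : ∀ y ∈ ball x r, IsNormalVector f y (ξ y) := fun y hy => by
    have he := hf.orthonormal y (hsub hy)
    rw [hf.isNormalVector_iff (hsub hy), lor_smul_left, lor_smul_left, he.lor_nullNormal_fst,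
      he.lor_nullNormal_snd, mul_zero]
    exact ⟨rfl, rfl⟩
  have hparallel : IsParallelField (ball x r) f ξ := .of_lor_eq_const (hf.mono isOpen_ball hsub)
    (hH.mono hsub) hξ hnormal hnull hone fun _ _ => by norm_num
  exact ⟨r, hr, hsub, ξ, hparallel, fun y hy => ⟨hnull y hy, hone y hy⟩⟩

end ParallelFields

section ParallelMeanCurvature

variable {E : Type*} [NormedAddCommGroup E] [NormedSpace ℝ E] {f ξ η H : E → L4}
  {X Y : E → E} {Ω U : Set E} {c d : ℝ} {x : E}

/-- `f` is a framed surface whose mean curvature vector is `H` and is parallel in the normal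
bundle. -/
structure IsParallelMeanCurvature (Ω : Set E) (f : E → L4) (X Y : E → E) (H : E → L4) : Prop
    extends IsFramedSurface Ω f X Y where
  isParallelField : IsParallelField Ω f H
  two_mul_lor : ∀ x ∈ Ω, ∀ n, IsNormalVector f x n →
    2 * lor (H x) n = lor (dirDeriv X (dirDeriv X f) x) n + lor (dirDeriv Y (dirDeriv Y f) x) n

namespace IsParallelMeanCurvature

theorem mono (h : IsParallelMeanCurvature Ω f X Y H) (hU : IsOpen U) (hUΩ : U ⊆ Ω) :
    IsParallelMeanCurvature U f X Y H where
  toIsFramedSurface := h.toIsFramedSurface.mono hU hUΩ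
  isParallelField := h.isParallelField.mono hUΩ
  two_mul_lor x hx := h.two_mul_lor x (hUΩ hx)

theorem lor_dirDeriv_fst_add_snd (h : IsParallelMeanCurvature Ω f X Y H)
    (hξ : IsParallelField Ω f ξ) (hx : x ∈ Ω) :
    lor (dirDeriv X ξ x) (dirDeriv X f x) + lor (dirDeriv Y ξ x) (dirDeriv Y f x) =
      -(2 * lor (ξ x) (H x)) := by
  have hf := h.toIsFramedSurface
  rw [hξ.lor_dirDeriv_dirDeriv hf hx hf.contDiffOn_fst,
    hξ.lor_dirDeriv_dirDeriv hf hx hf.contDiffOn_snd, lor_comm (ξ x),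
    h.two_mul_lor x hx _ (hξ.normal x hx), neg_add]

theorem isTracelessField (h : IsParallelMeanCurvature Ω f X Y H) (hξ : IsParallelField Ω f ξ)
    (hc : ∀ x ∈ Ω, lor (ξ x) (H x) = c) :
    IsTracelessField Ω f X Y (fun x => ξ x + c • f x) where
  contDiffOn := hξ.contDiffOn.add (h.contDiffOn.const_smul c)
  dirDeriv_eq x hx := by
    have hf := h.toIsFramedSurface
    have htrace := h.lor_dirDeriv_fst_add_snd hξ hx
    rw [hc x hx] at htrace
    have hd := hf.differentiableAt hf.contDiffOn hx
    have hd' := hf.differentiableAt hξ.contDiffOn hx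
    refine ⟨lor (dirDeriv X ξ x) (dirDeriv X f x) + c,
      lor (dirDeriv X ξ x) (dirDeriv Y f x), ?_, ?_⟩
    · rw [dirDeriv_add_const_smul hd' hd]
      linear_combination (norm := module) hξ.dirDeriv_eq hf hx X
    · rw [dirDeriv_add_const_smul hd' hd, hξ.lor_dirDeriv_fst_snd_comm hf hx]
      linear_combination (norm := module) hξ.dirDeriv_eq hf hx Y + htrace • dirDeriv Y f x

theorem hopf_div_hopf_im (h : IsParallelMeanCurvature Ω f X Y H) (hξ : IsParallelField Ω f ξ)
    (hη : IsParallelField Ω f η) (hc : ∀ x ∈ Ω, lor (ξ x) (H x) = c)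
    (hd : ∀ x ∈ Ω, lor (η x) (H x) = d) (hx : x ∈ Ω) :
    (hopf f X Y (fun x => ξ x + c • f x) x / hopf f X Y (fun x => η x + d • f x) x).im = 0 := by
  have hf := h.toIsFramedSurface
  have hcomm := hξ.lor_dirDeriv_dirDeriv_comm hf hη hx
  rw [hη.dirDeriv_eq hf hx X, hη.dirDeriv_eq hf hx Y] at hcomm
  simp only [lor_add_right, lor_smul_right, hη.lor_dirDeriv_fst_snd_comm hf hx,
    ← hξ.lor_dirDeriv_fst_snd_comm hf hx] at hcomm
  have htraceξ := h.lor_dirDeriv_fst_add_snd hξ hx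
  have htraceη := h.lor_dirDeriv_fst_add_snd hη hx
  rw [hc x hx] at htraceξ
  rw [hd x hx] at htraceη
  have hfx := hf.differentiableAt hf.contDiffOn hx
  rw [hopf_add_const_smul (hf.differentiableAt hξ.contDiffOn hx) hfx,
    hopf_add_const_smul (hf.differentiableAt hη.contDiffOn hx) hfx, hf.hopf_self hx, Complex.div_im,
    ← sub_div]
  refine div_eq_zero_iff.2 (.inl ?_)
  simp only [hopf, hη.lor_dirDeriv_fst_snd_comm hf hx, mul_one, Complex.add_re, Complex.add_im,
    Complex.ofReal_re, Complex.ofReal_im, add_zero]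
  linear_combination hcomm / 2 + lor (dirDeriv Y η x) (dirDeriv X f x) / 2 * htraceξ -
    lor (dirDeriv X ξ x) (dirDeriv Y f x) / 2 * htraceη

theorem exists_eventually_eq_sub_smul (h : IsParallelMeanCurvature Ω f X Y H)
    (hξ : IsParallelField Ω f ξ) (hc : ∀ y ∈ Ω, lor (ξ y) (H y) = c) (hx : x ∈ Ω)
    (hzero : ∀ᶠ y in 𝓝 x, hopf f X Y (fun y => ξ y + c • f y) y = 0) :
    ∃ A : L4, ∀ᶠ y in 𝓝 x, ξ y = A - c • f y := by
  have hW := h.isTracelessField hξ hc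
  have hΩ := h.isOpen.eventually_mem hx
  refine ⟨ξ x + c • f x, ?_⟩
  filter_upwards [eventually_eq_of_eventually_fderiv_eq_zero
    (hΩ.mono fun y hy => h.toIsFramedSurface.differentiableAt hW.contDiffOn hy)
    (hΩ.and hzero |>.mono fun y hy => (hW.hopf_eq_zero_iff h.toIsFramedSurface hy.1).1 hy.2)]
    with y hy using eq_sub_of_add_eq hy

/-- Unless the Hopf function of `H` vanishes, the one of a null parallel field `ν` is locally a
constant real multiple `t` of it, so that the Hopf function of `ν - tH` is zero. -/
theorem exists_eventually_hopf_eq_zero (h : IsParallelMeanCurvature Ω f X Y H) (hx : x ∈ Ω)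
    (hHx : H x ≠ 0) :
    ∃ (U : Set E) (ξ : E → L4) (c : ℝ), U ⊆ Ω ∧ IsOpen U ∧ IsParallelField U f ξ ∧
      (∀ y ∈ U, lor (ξ y) (H y) = c) ∧
      ∃ z ∈ U, ξ z ≠ 0 ∧ ∀ᶠ y in 𝓝 z, hopf f X Y (fun y => ξ y + c • f y) y = 0 := by
  obtain ⟨r, hr, hsub, ξ, hξ, hnull⟩ :=
    exists_null_parallelField h.toIsFramedSurface h.isParallelField hx hHx
  have hU := h.mono isOpen_ball hsub
  have hone : ∀ y ∈ ball x r, lor (ξ y) (H y) = 1 := fun y hy => (hnull y hy).2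
  obtain ⟨m, hm⟩ := hU.isParallelField.exists_lor_eq hU.isParallelField isOpen_ball
    (convex_ball x r).isPreconnected
  by_cases hzero : ∀ y ∈ ball x r, hopf f X Y (fun y => H y + m • f y) y = 0
  · exact ⟨ball x r, H, m, hsub, isOpen_ball, hU.isParallelField, hm, x, mem_ball_self hr, hHx,
      (isOpen_ball.eventually_mem (mem_ball_self hr)).mono hzero⟩
  push Not at hzero
  obtain ⟨z, hz, hne⟩ := hzero
  have hf := hU.toIsFramedSurface
  obtain ⟨t, ht⟩ := ((hU.isTracelessField hξ hone).isCauchyRiemannSolution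
    hf).eventually_eq_real_mul ((hU.isTracelessField hU.isParallelField hm).isCauchyRiemannSolution
    hf) hf.isMovingFrame (fun y hy => hU.hopf_div_hopf_im hξ hU.isParallelField hone hm hy) hz hne
  have htH := hU.isParallelField.const_smul isOpen_ball (-t)
  refine ⟨ball x r, fun y => ξ y + -t • H y, 1 + -t * m, hsub, isOpen_ball,
    hξ.add htH isOpen_ball, fun y hy => ?_, z, hz, fun hξz => ?_, ?_⟩
  · rw [lor_add_left, lor_smul_left, hone y hy, hm y hy]
  · have ht₀ := congrArg (lor · (ξ z)) hξz
    simp only [lor_add_left, lor_smul_left, lor_comm (H z), (hnull z hz).1, (hnull z hz).2,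
      lor_zero_left, zero_add, mul_one] at ht₀
    simp only [ht₀, zero_smul, add_zero] at hξz
    exact zero_ne_one (by rw [← hone z hz, hξz, lor_zero_left])
  · filter_upwards [ht, isOpen_ball.mem_nhds hz] with y hy hyU
    have hcomb : (fun y => ξ y + -t • H y + (1 + -t * m) • f y) =
        fun y => (ξ y + (1 : ℝ) • f y) + -t • (H y + m • f y) := by
      funext y
      module
    rw [hcomb, hopf_add_const_smul
      (hf.differentiableAt (hU.isTracelessField hξ hone).contDiffOn hyU)
      (hf.differentiableAt (hU.isTracelessField hU.isParallelField hm).contDiffOn hyU), hy]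
    push_cast
    ring

end IsParallelMeanCurvature

end ParallelMeanCurvature

section AffineNormals

variable {E : Type*} [NormedAddCommGroup E] [NormedSpace ℝ E] {f ξ H : E → L4}
  {X Y : E → E} {Ω : Set E} {A : L4} {m : ℝ} {x : E}

theorem IsFramedSurface.isParallelField_sub_smul (hf : IsFramedSurface Ω f X Y)
    (hn : ∀ y ∈ Ω, IsNormalVector f y (A - m • f y)) :
    IsParallelField Ω f (fun y => A - m • f y) where
  contDiffOn := contDiffOn_const.sub (hf.contDiffOn.const_smul m)
  normal := hn
  parallel y hy v := ⟨-m • v, by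
    rw [fderiv_const_sub, fderiv_fun_const_smul (hf.differentiableAt hf.contDiffOn hy), neg_apply,
      smul_apply, map_smul, neg_smul]⟩

namespace IsParallelMeanCurvature

theorem lor_sub_smul_eq (h : IsParallelMeanCurvature Ω f X Y H)
    (hn : ∀ y ∈ Ω, IsNormalVector f y (A - m • f y)) (hx : x ∈ Ω) :
    lor (A - m • f x) (H x) = m := by
  have hf := h.toIsFramedSurface
  have htrace := h.lor_dirDeriv_fst_add_snd (hf.isParallelField_sub_smul hn) hx
  have hderiv (Z : E → E) : dirDeriv Z (fun y => A - m • f y) x = -m • dirDeriv Z f x := by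
    rw [dirDeriv, fderiv_const_sub, fderiv_fun_const_smul (hf.differentiableAt hf.contDiffOn hx),
      neg_apply, smul_apply, neg_smul, dirDeriv]
  rw [hderiv, hderiv, lor_smul_left, lor_smul_left, (hf.orthonormal x hx).fst,
    (hf.orthonormal x hx).snd] at htrace
  linarith

theorem exists_eventually_isNormalVector (h : IsParallelMeanCurvature Ω f X Y H) (hx : x ∈ Ω)
    (hHx : H x ≠ 0) :
    ∃ (A : L4) (m : ℝ), (A ≠ 0 ∨ m ≠ 0) ∧
      ∃ z ∈ Ω, ∀ᶠ y in 𝓝 z, IsNormalVector f y (A - m • f y) := by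
  obtain ⟨U, ξ, m, hUΩ, hU, hξ, hm, z, hz, hξz, hopf_zero⟩ :=
    h.exists_eventually_hopf_eq_zero hx hHx
  obtain ⟨A, hA⟩ := (h.mono hU hUΩ).exists_eventually_eq_sub_smul hξ hm hz hopf_zero
  refine ⟨A, m, ?_, z, hUΩ hz, ?_⟩
  · by_contra! ⟨hA₀, hm₀⟩
    exact hξz (by rw [hA.self_of_nhds, hA₀, hm₀, zero_smul, sub_zero])
  · filter_upwards [hA, hU.mem_nhds hz] with y hy hyU using hy ▸ hξ.normal y hyU

section

variable (h : IsParallelMeanCurvature Ω f X Y H) (hΩ : IsPreconnected Ω)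
  (hξ : IsParallelField Ω f ξ) (hnull : ∀ y ∈ Ω, lor (ξ y) (ξ y) = 0 ∧ lor (ξ y) (H y) = 1)
  (hx : x ∈ Ω) (hn : ∀ᶠ y in 𝓝 x, IsNormalVector f y (A - m • f y))
include h hΩ hξ hnull hx hn

/-- The parallel normal field `A - mf` is a constant combination of `ξ` and `H`, which span the
normal bundle. -/
theorem exists_parallelField_eventually_eq_sub_smul :
    ∃ η, IsParallelField Ω f η ∧ (∀ y ∈ Ω, lor (η y) (H y) = m) ∧
      ∀ᶠ y in 𝓝 x, η y = A - m • f y := by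
  obtain ⟨r, hr, hball⟩ :=
    Metric.eventually_nhds_iff_ball.1 ((h.isOpen.eventually_mem hx).and hn)
  have hsub : ball x r ⊆ Ω := fun y hy => (hball y hy).1
  have hnU : ∀ y ∈ ball x r, IsNormalVector f y (A - m • f y) := fun y hy => (hball y hy).2
  have hU := h.mono isOpen_ball hsub
  obtain ⟨k, hk⟩ := h.isParallelField.exists_lor_eq h.isParallelField h.isOpen hΩ
  obtain ⟨b, hb⟩ := (hU.isParallelField_sub_smul hnU).exists_lor_eq (hξ.mono hsub) isOpen_ball
    (convex_ball x r).isPreconnected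
  set η : E → L4 := fun y => (m - b * k) • ξ y + b • H y
  have hη : IsParallelField Ω f η :=
    (hξ.const_smul h.isOpen _).add (h.isParallelField.const_smul h.isOpen _) h.isOpen
  have hηH : ∀ y ∈ Ω, lor (η y) (H y) = m := fun y hy => by
    rw [lor_add_left, lor_smul_left, lor_smul_left, (hnull y hy).2, hk y hy]
    ring
  refine ⟨η, hη, hηH, ?_⟩
  filter_upwards [isOpen_ball.mem_nhds (mem_ball_self hr)] with y hy
  have hyΩ := hsub hy
  have hηξ : lor (η y) (ξ y) = b := by
    rw [lor_add_left, lor_smul_left, lor_smul_left, lor_comm (H y), (hnull y hyΩ).1,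
      (hnull y hyΩ).2]
    ring
  have normal_iff {n : L4} := h.isNormalVector_iff hyΩ (n := n)
  have hξy := normal_iff.1 (hξ.normal y hyΩ)
  have hHy := normal_iff.1 (h.isParallelField.normal y hyΩ)
  have hηy := normal_iff.1 (hη.normal y hyΩ)
  have hny := normal_iff.1 (hnU y hy)
  refine sub_eq_zero.1 ((h.orthonormal y hyΩ).eq_zero_of_orthogonal_normal_basis hξy.1 hξy.2
    hHy.1 hHy.2 ?_ ?_ ?_ ?_ ?_)
  · rw [(hnull y hyΩ).1, (hnull y hyΩ).2]
    norm_num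
  · rw [lor_sub_left, hηy.1, hny.1, sub_zero]
  · rw [lor_sub_left, hηy.2, hny.2, sub_zero]
  · rw [lor_sub_left, hηξ, hb y hy, sub_self]
  · rw [lor_sub_left, hηH y hyΩ, hU.lor_sub_smul_eq hnU hy, sub_self]

end

end IsParallelMeanCurvature

end AffineNormals

section AffineNormalPropagation

variable {E : Type*} [NormedAddCommGroup E] [InnerProductSpace ℝ E] [ProperSpace E]
  {f ξ H : E → L4} {X Y : E → E} {Ω : Set E} {A : L4} {m : ℝ} {x : E}

namespace IsParallelMeanCurvature

theorem isNormalVector_of_eventually (h : IsParallelMeanCurvature Ω f X Y H)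
    (hΩ : IsPreconnected Ω) (hξ : IsParallelField Ω f ξ)
    (hnull : ∀ y ∈ Ω, lor (ξ y) (ξ y) = 0 ∧ lor (ξ y) (H y) = 1) (hx : x ∈ Ω)
    (hn : ∀ᶠ y in 𝓝 x, IsNormalVector f y (A - m • f y)) :
    ∀ y ∈ Ω, IsNormalVector f y (A - m • f y) := by
  obtain ⟨η, hη, hηH, hηx⟩ := h.exists_parallelField_eventually_eq_sub_smul hΩ hξ hnull hx hn
  have hf := h.toIsFramedSurface
  have hW := h.isTracelessField hη hηH
  have hWx : (fun y => η y + m • f y) =ᶠ[𝓝 x] fun _ => A := hηx.mono fun y hy => by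
    simp only [hy, sub_add_cancel]
  have hopf_zero_near : ∀ᶠ y in 𝓝 x, hopf f X Y (fun y => η y + m • f y) y = 0 := by
    filter_upwards [h.isOpen.mem_nhds hx, hWx.fderiv (𝕜 := ℝ)] with y hy hdy
    rw [hW.hopf_eq_zero_iff hf hy, hdy, fderiv_fun_const, Pi.zero_apply]
  have hopf_zero := (hW.isCauchyRiemannSolution hf).eq_zero_of_isPreconnected hf.isMovingFrame hΩ
    hx hopf_zero_near
  obtain ⟨B, hB⟩ := h.isOpen.exists_is_const_of_fderiv_eq_zero hΩ
    (fun y hy => (hf.differentiableAt hW.contDiffOn hy).differentiableWithinAt)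
    fun y hy => (hW.hopf_eq_zero_iff hf hy).1 (hopf_zero y hy)
  have hBA : B = A := (hB x hx).symm.trans hWx.self_of_nhds
  intro y hy
  rw [← hBA, ← hB y hy, add_sub_cancel_right]
  exact hη.normal y hy

theorem exists_ball_isNormalVector (h : IsParallelMeanCurvature Ω f X Y H) (hx : x ∈ Ω)
    (hHx : H x ≠ 0) :
    ∃ r > 0, ball x r ⊆ Ω ∧ ∀ (A : L4) (m : ℝ), ∀ z ∈ ball x r,
      (∀ᶠ y in 𝓝 z, IsNormalVector f y (A - m • f y)) →
        ∀ y ∈ ball x r, IsNormalVector f y (A - m • f y) := by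
  obtain ⟨r, hr, hsub, ξ, hξ, hnull⟩ :=
    exists_null_parallelField h.toIsFramedSurface h.isParallelField hx hHx
  exact ⟨r, hr, hsub, fun A m z hz hn => (h.mono isOpen_ball hsub).isNormalVector_of_eventually
    (convex_ball x r).isPreconnected hξ hnull hz hn⟩

end IsParallelMeanCurvature

end AffineNormalPropagation

section GramSchmidt

variable {E : Type*} [NormedAddCommGroup E] [NormedSpace ℝ E] {f : E → L4}
  {Z : E → E} {Ω : Set E} {x : E}

/-- The vector field `Z`, normalized in the metric induced by `f`. -/
noncomputable def normalizeField (f : E → L4) (Z : E → E) (x : E) : E :=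
  (√(lor (dirDeriv Z f x) (dirDeriv Z f x)))⁻¹ • Z x

theorem dirDeriv_normalizeField :
    dirDeriv (normalizeField f Z) f x =
      (√(lor (dirDeriv Z f x) (dirDeriv Z f x)))⁻¹ • dirDeriv Z f x :=
  map_smul _ _ _

theorem contDiffOn_normalizeField (hΩ : IsOpen Ω) (hf : ContDiffOn ℝ ∞ f Ω)
    (hZ : ContDiffOn ℝ ∞ Z Ω) (hpos : ∀ x ∈ Ω, 0 < lor (dirDeriv Z f x) (dirDeriv Z f x)) :
    ContDiffOn ℝ ∞ (normalizeField f Z) Ω :=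
  have hZf := contDiffOn_dirDeriv hZ hf hΩ
  (((contDiffOn_lor hZf hZf).sqrt fun x hx => (hpos x hx).ne').inv
    fun x hx => (Real.sqrt_pos.2 (hpos x hx)).ne').smul hZ

theorem lor_inv_sqrt_smul_self {a : L4} (ha : 0 < lor a a) :
    lor ((√(lor a a))⁻¹ • a) ((√(lor a a))⁻¹ • a) = 1 := by
  rw [lor_smul_left, lor_smul_right, ← mul_assoc, ← mul_inv, Real.mul_self_sqrt ha.le,
    inv_mul_cancel₀ ha.ne']

theorem exists_isFramedSurface (b : Module.Basis (Fin 2) ℝ E) (hΩ : IsOpen Ω)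
    (hf : ContDiffOn ℝ ∞ f Ω)
    (hpos : ∀ x ∈ Ω, ∀ v ≠ 0, 0 < lor (fderiv ℝ f x v) (fderiv ℝ f x v)) :
    ∃ X Y, IsFramedSurface Ω f X Y := by
  set X₀ : E → E := fun _ => b 0
  set r : E → ℝ := fun x => lor (fderiv ℝ f x (b 1)) (fderiv ℝ f x (b 0)) /
    lor (fderiv ℝ f x (b 0)) (fderiv ℝ f x (b 0))
  set Y₀ : E → E := fun x => b 1 - r x • b 0
  have hX₀ : ContDiffOn ℝ ∞ X₀ Ω := contDiffOn_const
  have hX₀pos : ∀ x ∈ Ω, 0 < lor (dirDeriv X₀ f x) (dirDeriv X₀ f x) := fun x hx =>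
    hpos x hx _ (b.ne_zero 0)
  have hr : ContDiffOn ℝ ∞ r Ω := by
    have h₀ := contDiffOn_dirDeriv hX₀ hf hΩ
    have h₁ := contDiffOn_dirDeriv (contDiffOn_const (c := b 1)) hf hΩ
    exact (contDiffOn_lor h₁ h₀).div (contDiffOn_lor h₀ h₀) fun x hx => (hX₀pos x hx).ne'
  have hY₀ : ContDiffOn ℝ ∞ Y₀ Ω := contDiffOn_const.sub (hr.smul contDiffOn_const)
  have hY₀ne : ∀ x, Y₀ x ≠ 0 := fun x h => by
    simpa [Y₀] using congrArg (b.repr · 1) h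
  have hY₀pos : ∀ x ∈ Ω, 0 < lor (dirDeriv Y₀ f x) (dirDeriv Y₀ f x) := fun x hx =>
    hpos x hx _ (hY₀ne x)
  refine ⟨normalizeField f X₀, normalizeField f Y₀, hΩ, hf,
    contDiffOn_normalizeField hΩ hf hX₀ hX₀pos, contDiffOn_normalizeField hΩ hf hY₀ hY₀pos,
    fun x hx v => ?_, fun x hx => ⟨?_, ?_, ?_⟩⟩
  · refine ⟨√(lor (dirDeriv X₀ f x) (dirDeriv X₀ f x)) * (b.repr v 0 + b.repr v 1 * r x),
      √(lor (dirDeriv Y₀ f x) (dirDeriv Y₀ f x)) * b.repr v 1, ?_⟩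
    rw [normalizeField, normalizeField, mul_comm, mul_comm (√_), mul_smul, mul_smul,
      smul_inv_smul₀ (Real.sqrt_pos.2 (hX₀pos x hx)).ne',
      smul_inv_smul₀ (Real.sqrt_pos.2 (hY₀pos x hx)).ne']
    conv_lhs => rw [← b.sum_repr v, Fin.sum_univ_two]
    module
  · rw [dirDeriv_normalizeField, lor_inv_sqrt_smul_self (hX₀pos x hx)]
  · rw [dirDeriv_normalizeField, lor_inv_sqrt_smul_self (hY₀pos x hx)]
  · rw [dirDeriv_normalizeField, dirDeriv_normalizeField, lor_smul_left, lor_smul_right]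
    refine mul_eq_zero_of_right _ (mul_eq_zero_of_right _ ?_)
    have hfX := (hX₀pos x hx).ne'
    simp only [dirDeriv, X₀, Y₀, r, map_sub, map_smul, lor_sub_right, lor_smul_right] at hfX ⊢
    rw [div_mul_cancel₀ _ hfX, lor_comm, sub_self]

end GramSchmidt

section ChangeOfParameters

variable {E F : Type*} [NormedAddCommGroup E] [NormedSpace ℝ E] [NormedAddCommGroup F]
  [NormedSpace ℝ F] {f : F → L4} {T : E → F} {x : E} {n : L4}

theorem lor_fderiv_fderiv_comp (hf : ContDiffAt ℝ 2 f (T x)) (hT : ContDiffAt ℝ 2 T x)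
    (hn : IsNormalVector f (T x) n) (v w : E) :
    lor (fderiv ℝ (fderiv ℝ (f ∘ T)) x v w) n =
      lor (fderiv ℝ (fderiv ℝ f) (T x) (fderiv ℝ T x v) (fderiv ℝ T x w)) n := by
  have hchain : fderiv ℝ (f ∘ T) =ᶠ[𝓝 x] fun y => (fderiv ℝ f (T y)).comp (fderiv ℝ T y) := by
    filter_upwards [hT.continuousAt.eventually (hf.eventually (by simp)), hT.eventually (by simp)]
      with y hfy hTy
    exact fderiv_comp y (hfy.differentiableAt (by simp)) (hTy.differentiableAt (by simp))
  have hdf : DifferentiableAt ℝ (fderiv ℝ f) (T x) :=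
    (hf.fderiv_right (m := 1) (by norm_num)).differentiableAt (by simp)
  have hdT : DifferentiableAt ℝ (fderiv ℝ T) x :=
    (hT.fderiv_right (m := 1) (by norm_num)).differentiableAt (by simp)
  have hTx := hT.differentiableAt (by simp)
  have hsecond : fderiv ℝ (fderiv ℝ (f ∘ T)) x v w =
      fderiv ℝ f (T x) (fderiv ℝ (fderiv ℝ T) x v w) +
        fderiv ℝ (fderiv ℝ f) (T x) (fderiv ℝ T x v) (fderiv ℝ T x w) := by
    rw [hchain.fderiv_eq]
    exact congrArg (· v w)
      ((hdf.hasFDerivAt.comp x hTx.hasFDerivAt).clm_comp hdT.hasFDerivAt).fderiv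
  rw [hsecond, lor_add_left, lor_comm, hn, zero_add]

end ChangeOfParameters

section Pointwise

variable {S : Type*} [TopologicalSpace S] [ChartedSpace Plane S] {ψ : S → L4} {y : S}
  {u₁ u₂ : Plane} {a b w z : L4}

theorem IsOrthonormalPair.perp_congr (hab : IsOrthonormalPair a b)
    (h : ∀ n, lor n a = 0 → lor n b = 0 → lor w n = lor z n) : perp a b w = perp a b z := by
  have hwz := hab.eq_of_orthogonal_normals (w := w - z) fun n ha hb => by
    rw [lor_sub_left, h n ha hb, sub_self]
  rw [lor_sub_left, lor_sub_left] at hwz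
  unfold perp
  linear_combination (norm := module) hwz

theorem eq_smul_coordVec_add (v : Plane) : v = v 0 • coordVec 0 + v 1 • coordVec 1 := by
  ext i
  fin_cases i <;> simp [coordVec]

theorem diff_eq_smul_add (v : Plane) :
    diff ψ y v = v 0 • diff ψ y (coordVec 0) + v 1 • diff ψ y (coordVec 1) := by
  let dψ : Plane →L[ℝ] L4 := mfderiv (𝓡 2) 𝓘(ℝ, L4) ψ y
  calc dψ v = dψ (v 0 • coordVec 0 + v 1 • coordVec 1) := by rw [← eq_smul_coordVec_add]
    _ = _ := by rw [map_add, map_smul, map_smul]; rfl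

theorem gram_inv_apply (h : IsOrthonormalPair (diff ψ y u₁) (diff ψ y u₂)) (i j : Fin 2) :
    (gram ψ y)⁻¹ i j = u₁ i * u₁ j + u₂ i * u₂ j := by
  set P : Matrix (Fin 2) (Fin 2) ℝ := !![u₁ 0, u₂ 0; u₁ 1, u₂ 1]
  have horth : P.transpose * (gram ψ y * P) = 1 := by
    have h₁ := h.fst
    have h₂ := h.snd
    have h₁₂ := h.fst_snd
    have h₂₁ := h.lor_snd_fst
    simp only [diff_eq_smul_add u₁, diff_eq_smul_add u₂, lor_add_left, lor_add_right,
      lor_smul_left, lor_smul_right] at h₁ h₂ h₁₂ h₂₁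
    ext i j
    fin_cases i <;> fin_cases j <;>
      (simp [P, gram, Matrix.mul_apply, Fin.sum_univ_two]; linarith)
  have hinv : (gram ψ y)⁻¹ = P * P.transpose :=
    Matrix.inv_eq_right_inv (by rw [← mul_assoc]; exact mul_eq_one_comm.1 horth)
  rw [hinv]
  fin_cases i <;> fin_cases j <;> simp [P, Matrix.mul_apply, Fin.sum_univ_two]

theorem normalPart_eq_perp (h : IsOrthonormalPair (diff ψ y u₁) (diff ψ y u₂)) (w : L4) :
    normalPart ψ y w = perp (diff ψ y u₁) (diff ψ y u₂) w := by
  rw [diff_eq_smul_add u₁, diff_eq_smul_add u₂]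
  simp only [normalPart, perp, gram_inv_apply h, Fin.sum_univ_two, lor_add_right, lor_smul_right]
  module

theorem meanCurv_eq_perp (h : IsOrthonormalPair (diff ψ y u₁) (diff ψ y u₂)) :
    meanCurv ψ y = (1 / 2 : ℝ) •
      perp (diff ψ y u₁) (diff ψ y u₂) (hessian ψ y u₁ u₁ + hessian ψ y u₂ u₂) := by
  have htrace : hessian ψ y u₁ u₁ + hessian ψ y u₂ u₂ =
      ∑ i, ∑ j, (gram ψ y)⁻¹ i j • hessian ψ y (coordVec i) (coordVec j) := by
    unfold hessian
    conv_lhs => rw [eq_smul_coordVec_add u₁, eq_smul_coordVec_add u₂]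
    simp only [map_add, map_smul, add_apply, smul_apply, gram_inv_apply h, Fin.sum_univ_two]
    module
  rw [htrace]
  simp only [meanCurv, secondForm, normalPart_eq_perp h, perp, Fin.sum_univ_two, lor_add_left,
    lor_smul_left]
  module

end Pointwise

section Charts

variable {S : Type*} [TopologicalSpace S] [ChartedSpace Plane S] {ψ ξ : S → L4} {p y : S}

/-- The function `F` read in the preferred chart at `p`; only its values on the target of that chart
are meaningful. -/
abbrev inChart {V : Type*} (F : S → V) (p : S) : Plane → V :=
  F ∘ (chartAt Plane p).symm

/-- The change of coordinates from the preferred chart at `y` to the preferred chart at `p`. -/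
abbrev chartChange (p y : S) : Plane → Plane :=
  inChart (chartAt Plane p) y

/-- `n` is orthogonal to the surface `ψ` at `y`. -/
def IsNormalAt (ψ : S → L4) (y : S) (n : L4) : Prop :=
  ∀ v, lor n (diff ψ y v) = 0

theorem inChart_chartAt {V : Type*} {F : S → V} (hy : y ∈ (chartAt Plane p).source) :
    inChart F p (chartAt Plane p y) = F y := by
  rw [inChart, Function.comp_apply, (chartAt Plane p).left_inv hy]

theorem chartChange_self (p y : S) : chartChange p y (chartAt Plane y y) = chartAt Plane p y :=
  inChart_chartAt (mem_chart_source Plane y)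

theorem eventually_mem_chartAt_source (hy : y ∈ (chartAt Plane p).source) :
    ∀ᶠ x in 𝓝 (chartAt Plane y y), (chartAt Plane y).symm x ∈ (chartAt Plane p).source :=
  ((chartAt Plane y).continuousAt_symm (mem_chart_target Plane y)).eventually <| by
    rw [(chartAt Plane y).left_inv (mem_chart_source Plane y)]
    exact (chartAt Plane p).open_source.mem_nhds hy

theorem inChart_eventuallyEq {V : Type*} (F : S → V) (hy : y ∈ (chartAt Plane p).source) :
    inChart F y =ᶠ[𝓝 (chartAt Plane y y)] inChart F p ∘ chartChange p y := by
  filter_upwards [eventually_mem_chartAt_source hy] with x hx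
  exact (inChart_chartAt hx).symm

variable [IsManifold (𝓡 2) ∞ S]

theorem contDiffAt_chartChange (hy : y ∈ (chartAt Plane p).source) :
    ContDiffAt ℝ ∞ (chartChange p y) (chartAt Plane y y) := by
  refine contMDiffAt_iff_contDiffAt.1 (ContMDiffAt.comp (I' := 𝓡 2) _ ?_
    (contMDiffOn_chart_symm.contMDiffAt (chart_target_mem_nhds Plane y)))
  rw [(chartAt Plane y).left_inv (mem_chart_source Plane y)]
  exact contMDiffOn_chart.contMDiffAt ((chartAt Plane p).open_source.mem_nhds hy)

/-- The differential at `y` of the preferred chart at `p`, in the coordinates of the preferred chart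
at `y`. -/
noncomputable def chartDeriv (p y : S) : Plane →L[ℝ] Plane :=
  fderiv ℝ (chartChange p y) (chartAt Plane y y)

theorem chartDeriv_eq_mfderiv (hy : y ∈ (chartAt Plane p).source) :
    chartDeriv p y = mfderiv (𝓡 2) 𝓘(ℝ, Plane) (chartAt Plane p) y := by
  rw [(mdifferentiableAt_atlas (chart_mem_atlas Plane p) hy).mfderiv]
  simp only [writtenInExtChartAt, extChartAt, OpenPartialHomeomorph.extend,
    modelWithCornersSelf_partialEquiv, PartialEquiv.trans_refl, PartialHomeomorph.toFun_eq_coe,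
    OpenPartialHomeomorph.coe_toPartialHomeomorph, PartialHomeomorph.coe_toPartialEquiv_symm,
    OpenPartialHomeomorph.coe_toPartialHomeomorph_symm, modelWithCornersSelf_coe, range_id,
    fderivWithin_univ]
  rfl

theorem chartDeriv_surjective (hy : y ∈ (chartAt Plane p).source) :
    Function.Surjective (chartDeriv p y) := by
  rw [chartDeriv_eq_mfderiv hy]
  exact (mdifferentiable_chart p).mfderiv_surjective hy

theorem diff_eq_fderiv_inChart (hy : y ∈ (chartAt Plane p).source)
    (hξ : DifferentiableAt ℝ (inChart ξ p) (chartAt Plane p y)) (v : Plane) :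
    diff ξ y v = fderiv ℝ (inChart ξ p) (chartAt Plane p y) (chartDeriv p y v) := by
  have heq : ξ =ᶠ[𝓝 y] inChart ξ p ∘ chartAt Plane p := by
    filter_upwards [(chartAt Plane p).open_source.mem_nhds hy] with z hz
    exact (inChart_chartAt hz).symm
  have hφ := mdifferentiableAt_atlas (I := 𝓡 2) (chart_mem_atlas Plane p) hy
  rw [diff, heq.mfderiv_eq, mfderiv_comp y hξ.mdifferentiableAt hφ, chartDeriv_eq_mfderiv hy,
    mfderiv_eq_fderiv]
  rfl

end Charts

section FrameMeanCurvature

variable {E : Type*} [NormedAddCommGroup E] [NormedSpace ℝ E] {f : E → L4} {X Y : E → E}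
  {Ω : Set E} {x : E} {n : L4}

/-- The mean curvature vector `½ (II(X, X) + II(Y, Y))` of the surface `f` with orthonormal frame
`X`, `Y`. -/
noncomputable def frameMeanCurv (f : E → L4) (X Y : E → E) (x : E) : L4 :=
  (1 / 2 : ℝ) • perp (dirDeriv X f x) (dirDeriv Y f x)
    (dirDeriv X (dirDeriv X f) x + dirDeriv Y (dirDeriv Y f) x)

theorem two_mul_lor_frameMeanCurv (hn : IsNormalVector f x n) :
    2 * lor (frameMeanCurv f X Y x) n =
      lor (dirDeriv X (dirDeriv X f) x) n + lor (dirDeriv Y (dirDeriv Y f) x) n := by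
  have hperp := lor_perp_right_of_orthogonal (a := dirDeriv X f x) (b := dirDeriv Y f x)
    (hn (X x)) (hn (Y x))
  rw [frameMeanCurv, lor_comm, lor_smul_right, hperp, lor_add_right, lor_comm n, lor_comm n]
  ring

namespace IsFramedSurface

theorem contDiffOn_frameMeanCurv (hf : IsFramedSurface Ω f X Y) :
    ContDiffOn ℝ ∞ (frameMeanCurv f X Y) Ω :=
  have hX := hf.contDiffOn_dirDeriv_fst hf.contDiffOn
  have hY := hf.contDiffOn_dirDeriv_snd hf.contDiffOn
  (contDiffOn_perp hX hY
    ((hf.contDiffOn_dirDeriv_fst hX).add (hf.contDiffOn_dirDeriv_snd hY))).const_smul _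

theorem isNormalVector_frameMeanCurv (hf : IsFramedSurface Ω f X Y) (hx : x ∈ Ω) :
    IsNormalVector f x (frameMeanCurv f X Y x) := by
  rw [hf.isNormalVector_iff hx, frameMeanCurv, lor_smul_left, lor_smul_left,
    (hf.orthonormal x hx).lor_perp_fst, (hf.orthonormal x hx).lor_perp_snd]
  simp only [mul_zero, and_self]

theorem lor_dirDeriv_dirDeriv_self (hf : IsFramedSurface Ω f X Y) (hx : x ∈ Ω) {Z : E → E}
    (hZ : ContDiffOn ℝ ∞ Z Ω) (hn : IsNormalVector f x n) :
    lor (dirDeriv Z (dirDeriv Z f) x) n = lor (fderiv ℝ (fderiv ℝ f) x (Z x) (Z x)) n := by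
  rw [dirDeriv_dirDeriv (hf.differentiableAt hZ hx) (hf.differentiableAt
    (hf.contDiffOn.fderiv_of_isOpen hf.isOpen (by simp)) hx), lor_add_left,
    lor_comm (fderiv ℝ f x _), hn, add_zero]

end IsFramedSurface

end FrameMeanCurvature

section SpacelikeCharts

variable {S : Type*} [TopologicalSpace S] [ChartedSpace Plane S] [IsManifold (𝓡 2) ∞ S]
  {ψ : S → L4} {X Y : Plane → Plane} {p y : S} {n : L4}

namespace IsSpacelike

theorem contDiffOn_inChart (hψ : IsSpacelike ψ) (p : S) :
    ContDiffOn ℝ ∞ (inChart ψ p) (chartAt Plane p).target :=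
  contMDiffOn_iff_contDiffOn.1 (hψ.smooth.comp_contMDiffOn contMDiffOn_chart_symm)

theorem diff_eq (hψ : IsSpacelike ψ) (hy : y ∈ (chartAt Plane p).source) (v : Plane) :
    diff ψ y v = fderiv ℝ (inChart ψ p) (chartAt Plane p y) (chartDeriv p y v) :=
  diff_eq_fderiv_inChart hy (differentiableAt_of_contDiffOn (hψ.contDiffOn_inChart p)
    (chartAt Plane p).open_target ((chartAt Plane p).map_source hy)) v

theorem isNormalAt_iff (hψ : IsSpacelike ψ) (hy : y ∈ (chartAt Plane p).source) :
    IsNormalAt ψ y n ↔ IsNormalVector (inChart ψ p) (chartAt Plane p y) n := by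
  rw [IsNormalVector, (chartDeriv_surjective hy).forall]
  exact forall_congr' fun v => by rw [hψ.diff_eq hy]

theorem exists_isFramedSurface_inChart (hψ : IsSpacelike ψ) (p : S) :
    ∃ X Y, IsFramedSurface (chartAt Plane p).target (inChart ψ p) X Y := by
  refine exists_isFramedSurface (EuclideanSpace.basisFun (Fin 2) ℝ).toBasis
    (chartAt Plane p).open_target (hψ.contDiffOn_inChart p) fun x hx v hv => ?_
  have hy := (chartAt Plane p).map_target hx
  obtain ⟨w, rfl⟩ := chartDeriv_surjective hy v
  have hpos := hψ.pos ((chartAt Plane p).symm x) w (by rintro rfl; exact hv (map_zero _))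
  rwa [hψ.diff_eq hy, (chartAt Plane p).right_inv hx] at hpos

theorem lor_hessian (hψ : IsSpacelike ψ) (hy : y ∈ (chartAt Plane p).source)
    (hn : IsNormalAt ψ y n) (v w : Plane) :
    lor (hessian ψ y v w) n = lor (fderiv ℝ (fderiv ℝ (inChart ψ p)) (chartAt Plane p y)
      (chartDeriv p y v) (chartDeriv p y w)) n := by
  have hf := ((hψ.contDiffOn_inChart p).contDiffAt ((chartAt Plane p).open_target.mem_nhds
    ((chartAt Plane p).map_source hy))).of_le (m := 2) ENat.LEInfty.out
  have hn' := (hψ.isNormalAt_iff hy).1 hn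
  rw [← chartChange_self p y] at hf hn' ⊢
  rw [hessian, (inChart_eventuallyEq ψ hy).fderiv.fderiv_eq]
  exact lor_fderiv_fderiv_comp hf ((contDiffAt_chartChange hy).of_le ENat.LEInfty.out) hn' v w

theorem exists_diff_eq_dirDeriv (hψ : IsSpacelike ψ) (hy : y ∈ (chartAt Plane p).source)
    (Z : Plane → Plane) : ∃ u, chartDeriv p y u = Z (chartAt Plane p y) ∧
      diff ψ y u = dirDeriv Z (inChart ψ p) (chartAt Plane p y) := by
  obtain ⟨u, hu⟩ := chartDeriv_surjective hy (Z (chartAt Plane p y))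
  exact ⟨u, hu, by rw [hψ.diff_eq hy, hu, dirDeriv]⟩

variable (hψ : IsSpacelike ψ) (hf : IsFramedSurface (chartAt Plane p).target (inChart ψ p) X Y)
include hψ hf

theorem normalPart_eq_perp_dirDeriv (hy : y ∈ (chartAt Plane p).source) (w : L4) :
    normalPart ψ y w = perp (dirDeriv X (inChart ψ p) (chartAt Plane p y))
      (dirDeriv Y (inChart ψ p) (chartAt Plane p y)) w := by
  obtain ⟨u₁, -, hu₁⟩ := hψ.exists_diff_eq_dirDeriv hy X
  obtain ⟨u₂, -, hu₂⟩ := hψ.exists_diff_eq_dirDeriv hy Y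
  have horth := hf.orthonormal _ ((chartAt Plane p).map_source hy)
  rw [← hu₁, ← hu₂] at horth ⊢
  exact normalPart_eq_perp horth w

theorem meanCurv_eq (hy : y ∈ (chartAt Plane p).source) :
    meanCurv ψ y = frameMeanCurv (inChart ψ p) X Y (chartAt Plane p y) := by
  have hx := (chartAt Plane p).map_source hy
  have horth := hf.orthonormal _ hx
  obtain ⟨u₁, hu₁, hψu₁⟩ := hψ.exists_diff_eq_dirDeriv hy X
  obtain ⟨u₂, hu₂, hψu₂⟩ := hψ.exists_diff_eq_dirDeriv hy Y
  rw [meanCurv_eq_perp (hψu₁ ▸ hψu₂ ▸ horth), hψu₁, hψu₂, frameMeanCurv]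
  refine congrArg _ (horth.perp_congr fun n hX hY => ?_)
  have hn := (hf.isNormalVector_iff hx).2 ⟨hX, hY⟩
  have hnψ := (hψ.isNormalAt_iff hy).2 hn
  rw [lor_add_left, lor_add_left, hψ.lor_hessian hy hnψ, hψ.lor_hessian hy hnψ, hu₁, hu₂,
    hf.lor_dirDeriv_dirDeriv_self hx hf.contDiffOn_fst hn,
    hf.lor_dirDeriv_dirDeriv_self hx hf.contDiffOn_snd hn]

theorem eqOn_inChart_meanCurv :
    EqOn (inChart (meanCurv ψ) p) (frameMeanCurv (inChart ψ p) X Y) (chartAt Plane p).target :=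
  fun x hx => by
    rw [inChart, Function.comp_apply, hψ.meanCurv_eq hf ((chartAt Plane p).map_target hx),
      (chartAt Plane p).right_inv hx]

theorem isParallelField_meanCurv (hpar : HasParallelMeanCurv ψ) :
    IsParallelField (chartAt Plane p).target (inChart ψ p) (inChart (meanCurv ψ) p) where
  contDiffOn := hf.contDiffOn_frameMeanCurv.congr (hψ.eqOn_inChart_meanCurv hf)
  normal x hx := by
    rw [hψ.eqOn_inChart_meanCurv hf hx]
    exact hf.isNormalVector_frameMeanCurv hx
  parallel x hx v := by
    have hy := (chartAt Plane p).map_target hx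
    obtain ⟨w, rfl⟩ := chartDeriv_surjective hy v
    have hd := hf.differentiableAt
      (hf.contDiffOn_frameMeanCurv.congr (hψ.eqOn_inChart_meanCurv hf)) hx
    have hperp := hpar ((chartAt Plane p).symm x) w
    rw [← (chartAt Plane p).right_inv hx] at hd
    rw [normalConn, hψ.normalPart_eq_perp_dirDeriv hf hy, diff_eq_fderiv_inChart hy hd,
      (chartAt Plane p).right_inv hx] at hperp
    have htangent := eq_of_perp_eq_zero hperp
    simp only [dirDeriv, ← map_smul, ← map_add] at htangent
    exact ⟨_, htangent⟩

theorem isParallelMeanCurvature (hpar : HasParallelMeanCurv ψ) :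
    IsParallelMeanCurvature (chartAt Plane p).target (inChart ψ p) X Y
      (inChart (meanCurv ψ) p) where
  toIsFramedSurface := hf
  isParallelField := hψ.isParallelField_meanCurv hf hpar
  two_mul_lor x hx n hn := by
    rw [hψ.eqOn_inChart_meanCurv hf hx, two_mul_lor_frameMeanCurv hn]

end IsSpacelike

end SpacelikeCharts

section Global

variable {S : Type*} [TopologicalSpace S] [ChartedSpace Plane S]

theorem apply_eq_of_hasFDerivAt_inChart_zero [PreconnectedSpace S] {V : Type*}
    [NormedAddCommGroup V] [NormedSpace ℝ V] {F : S → V}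
    (hF : ∀ p, ∀ x ∈ (chartAt Plane p).target, HasFDerivAt (inChart F p) (0 : Plane →L[ℝ] V) x)
    (y z : S) : F y = F z := by
  refine ((IsLocallyConstant.iff_eventually_eq F).2 fun p => ?_).apply_eq_of_preconnectedSpace y z
  have hp := mem_chart_source Plane p
  have hder : ∀ᶠ x in 𝓝 (chartAt Plane p p), HasFDerivAt (inChart F p) (0 : Plane →L[ℝ] V) x := by
    filter_upwards [chart_target_mem_nhds Plane p] with x hx using hF p x hx
  have hconst := eventually_eq_of_eventually_fderiv_eq_zero
    (hder.mono fun x hx => hx.differentiableAt) (hder.mono fun x hx => hx.fderiv)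
  filter_upwards [(chartAt Plane p).open_source.mem_nhds hp,
    ((chartAt Plane p).continuousAt hp).eventually hconst] with y hy hy'
  rwa [inChart_chartAt hy, inChart_chartAt hp] at hy'

theorem lor_apply_eq_of_isParallelField [PreconnectedSpace S] {ψ ξ η : S → L4}
    (hξ : ∀ p, IsParallelField (chartAt Plane p).target (inChart ψ p) (inChart ξ p))
    (hη : ∀ p, IsParallelField (chartAt Plane p).target (inChart ψ p) (inChart η p)) (y z : S) :
    lor (ξ y) (η y) = lor (ξ z) (η z) := by
  refine apply_eq_of_hasFDerivAt_inChart_zero (F := fun y => lor (ξ y) (η y)) (fun p x hx => ?_) y z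
  have hd := differentiableAt_of_contDiffOn
    (contDiffOn_lor (hξ p).contDiffOn (hη p).contDiffOn) (chartAt Plane p).open_target hx
  exact (hξ p).fderiv_lor_eq_zero (hη p) (chartAt Plane p).open_target hx ▸ hd.hasFDerivAt

variable [IsManifold (𝓡 2) ∞ S] {ψ : S → L4} {A : L4} {m : ℝ} {p y : S}

namespace IsSpacelike

theorem meanCurv_ne_zero [PreconnectedSpace S] (hψ : IsSpacelike ψ)
    (hpar : HasParallelMeanCurv ψ) (hmax : ¬IsMaximal ψ) (y : S) : meanCurv ψ y ≠ 0 := by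
  have hloc : IsLocallyConstant (fun y => meanCurv ψ y = 0) := by
    refine (IsLocallyConstant.iff_eventually_eq _).2 fun p => ?_
    obtain ⟨X, Y, hf⟩ := hψ.exists_isFramedSurface_inChart p
    have hH := hψ.isParallelField_meanCurv hf hpar
    have hp := mem_chart_source Plane p
    have hsource := (chartAt Plane p).open_source.mem_nhds hp
    have hcont := (chartAt Plane p).continuousAt hp
    by_cases h₀ : meanCurv ψ p = 0
    · have h₀' := inChart_chartAt (F := meanCurv ψ) hp ▸ h₀
      filter_upwards [hsource, hcont.eventually
        (hH.eventually_eq_zero hf (mem_chart_target Plane p) h₀')] with y hy hy₀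
      rw [inChart_chartAt hy] at hy₀
      simp only [hy₀, h₀]
    · have h₀' := inChart_chartAt (F := meanCurv ψ) hp ▸ h₀
      filter_upwards [hsource, hcont.eventually ((hf.differentiableAt hH.contDiffOn
        (mem_chart_target Plane p)).continuousAt.eventually_ne h₀')] with y hy hy₀
      rw [inChart_chartAt hy] at hy₀
      simp only [hy₀, h₀]
  exact fun hy => hmax fun z => (hloc.apply_eq_of_preconnectedSpace y z).mp hy

theorem eventually_isNormalAt_iff (hψ : IsSpacelike ψ) (hy : y ∈ (chartAt Plane p).source) :
    (∀ᶠ z in 𝓝 y, IsNormalAt ψ z (A - m • ψ z)) ↔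
      ∀ᶠ x in 𝓝 (chartAt Plane p y),
        IsNormalVector (inChart ψ p) x (A - m • inChart ψ p x) := by
  rw [(chartAt Plane p).eventually_nhds _ hy]
  refine eventually_congr ?_
  filter_upwards [(chartAt Plane p).open_source.mem_nhds hy] with z hz
  rw [hψ.isNormalAt_iff hz, inChart_chartAt hz]

theorem isNormalAt_meanCurv (hψ : IsSpacelike ψ) (y : S) : IsNormalAt ψ y (meanCurv ψ y) := by
  obtain ⟨X, Y, hf⟩ := hψ.exists_isFramedSurface_inChart y
  rw [hψ.isNormalAt_iff (mem_chart_source Plane y), hψ.meanCurv_eq hf (mem_chart_source Plane y)]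
  exact hf.isNormalVector_frameMeanCurv (mem_chart_target Plane y)

variable (hψ : IsSpacelike ψ) (hpar : HasParallelMeanCurv ψ)
include hψ hpar

theorem isClopen_setOf_eventually_isNormalAt (hne : ∀ y, meanCurv ψ y ≠ 0) (A : L4) (m : ℝ) :
    IsClopen {y | ∀ᶠ z in 𝓝 y, IsNormalAt ψ z (A - m • ψ z)} := by
  refine ⟨isClosed_iff_frequently.2 fun p hfreq => ?_, isOpen_setOfPred_eventually_nhds⟩
  have hp := mem_chart_source Plane p
  obtain ⟨X, Y, hf⟩ := hψ.exists_isFramedSurface_inChart p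
  obtain ⟨r, hr, -, hball⟩ := (hψ.isParallelMeanCurvature hf hpar).exists_ball_isNormalVector
    (mem_chart_target Plane p) (by rw [inChart_chartAt hp]; exact hne p)
  have hnear : ∀ᶠ z in 𝓝 p, z ∈ (chartAt Plane p).source ∧
      chartAt Plane p z ∈ ball (chartAt Plane p p) r :=
    ((chartAt Plane p).open_source.eventually_mem hp).and
      (((chartAt Plane p).continuousAt hp).eventually (ball_mem_nhds _ hr))
  obtain ⟨z, hz, hzs, hzr⟩ := (hfreq.and_eventually hnear).exists
  refine (hψ.eventually_isNormalAt_iff hp).2 ?_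
  filter_upwards [ball_mem_nhds _ hr] with x hx
  exact hball A m _ hzr ((hψ.eventually_isNormalAt_iff hzs).1 hz) x hx

theorem exists_forall_isNormalAt [ConnectedSpace S] (hmax : ¬IsMaximal ψ) :
    ∃ (A : L4) (m : ℝ), (A ≠ 0 ∨ m ≠ 0) ∧ ∀ y, IsNormalAt ψ y (A - m • ψ y) := by
  have hne := hψ.meanCurv_ne_zero hpar hmax
  obtain ⟨p⟩ := ConnectedSpace.toNonempty (α := S)
  obtain ⟨X, Y, hf⟩ := hψ.exists_isFramedSurface_inChart p
  obtain ⟨A, m, hAm, x, hx, hn⟩ :=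
    (hψ.isParallelMeanCurvature hf hpar).exists_eventually_isNormalVector
      (mem_chart_target Plane p) (by rw [inChart_chartAt (mem_chart_source Plane p)]; exact hne p)
  rw [← (chartAt Plane p).right_inv hx] at hn
  have huniv := (hψ.isClopen_setOf_eventually_isNormalAt hpar hne A m).eq_univ
    ⟨_, (hψ.eventually_isNormalAt_iff ((chartAt Plane p).map_target hx)).2 hn⟩
  exact ⟨A, m, hAm, fun y => (eq_univ_iff_forall.1 huniv y).self_of_nhds⟩

theorem lor_meanCurv_self_eq [PreconnectedSpace S] (y z : S) :
    lor (meanCurv ψ y) (meanCurv ψ y) = lor (meanCurv ψ z) (meanCurv ψ z) := by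
  have hH (p : S) : IsParallelField (chartAt Plane p).target (inChart ψ p)
      (inChart (meanCurv ψ) p) := by
    obtain ⟨X, Y, hf⟩ := hψ.exists_isFramedSurface_inChart p
    exact hψ.isParallelField_meanCurv hf hpar
  exact lor_apply_eq_of_isParallelField hH hH y z

theorem lor_sub_smul_meanCurv_eq (hn : ∀ y, IsNormalAt ψ y (A - m • ψ y)) (y : S) :
    lor (A - m • ψ y) (meanCurv ψ y) = m := by
  have hy := mem_chart_source Plane y
  obtain ⟨X, Y, hf⟩ := hψ.exists_isFramedSurface_inChart y
  have h := (hψ.isParallelMeanCurvature hf hpar).lor_sub_smul_eq (A := A) (m := m) (fun x hx => ?_)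
    (mem_chart_target Plane y)
  · rwa [inChart_chartAt hy, inChart_chartAt hy] at h
  · have hx' := (hψ.isNormalAt_iff ((chartAt Plane y).map_target hx)).1 (hn _)
    rwa [(chartAt Plane y).right_inv hx] at hx'

end IsSpacelike

end Global

section UmbilicalQuadrics

variable {A : L4} {m : ℝ}

/-- The hyperquadric `m⟨x, x⟩ - 2⟨A, x⟩ + c = 0`, whose normal at `x` is `A - mx`: a hyperplane for
`m = 0`, a quadric with centre `A / m` otherwise. -/
noncomputable def umbilicalQuadric (A : L4) (m c : ℝ) : Hyperquadric where
  form := m • lorForm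
  symm x y := congrArg (m * ·) (lor_comm x y)
  lin := (-2 : ℝ) • lorForm A
  const := c

theorem eval_umbilicalQuadric (A : L4) (m c : ℝ) (x : L4) :
    (umbilicalQuadric A m c).eval x = m * lor x x - 2 * lor A x + c := by
  simp only [Hyperquadric.eval, umbilicalQuadric, LinearMap.smul_apply, lorForm_apply, smul_eq_mul]
  ring

theorem deriv_umbilicalQuadric (A : L4) (m c : ℝ) (x v : L4) :
    (umbilicalQuadric A m c).deriv x v = -2 * lor (A - m • x) v := by
  simp only [Hyperquadric.deriv, umbilicalQuadric, LinearMap.smul_apply, lorForm_apply, smul_eq_mul,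
    lor_sub_left, lor_smul_left]
  ring

theorem isTotallyUmbilical_umbilicalQuadric (A : L4) (m c : ℝ) :
    (umbilicalQuadric A m c).IsTotallyUmbilical :=
  fun _ _ => ⟨2 * m, fun v w _ _ => (mul_assoc 2 m (lor v w)).symm⟩

theorem mem_locus_umbilicalQuadric {c : ℝ} {x : L4} :
    x ∈ (umbilicalQuadric A m c).locus ↔
      (umbilicalQuadric A m c).eval x = 0 ∧ A - m • x ≠ 0 := by
  rw [Hyperquadric.locus, mem_ofPred_eq]
  refine and_congr_right fun _ => ⟨?_, fun hx => ?_⟩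
  · rintro ⟨v, hv⟩ hx
    exact hv (by rw [deriv_umbilicalQuadric, hx, lor_zero_left, mul_zero])
  · contrapose! hx
    exact eq_zero_of_forall_lor_eq_zero fun v => by simpa [deriv_umbilicalQuadric] using hx v

theorem locus_umbilicalQuadric_zero (hA : A ≠ 0) (c : ℝ) :
    (umbilicalQuadric A 0 c).locus = hyperplane A (c / 2) := by
  ext x
  rw [mem_locus_umbilicalQuadric, eval_umbilicalQuadric, zero_smul, sub_zero, hyperplane,
    mem_ofPred_eq]
  exact ⟨fun h => by linarith [h.1], fun h => ⟨by linarith, hA⟩⟩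

theorem locus_umbilicalQuadric (hm : m ≠ 0) (A : L4) (c : ℝ) :
    (umbilicalQuadric A m c).locus =
      centralQuadric (m⁻¹ • A) (lor A A / m ^ 2 - c / m) := by
  ext x
  have hcentre : A - m • x ≠ 0 ↔ x ≠ m⁻¹ • A := by
    rw [sub_ne_zero, ne_comm, ne_eq, ne_eq, eq_inv_smul_iff₀ hm]
  rw [mem_locus_umbilicalQuadric, eval_umbilicalQuadric, hcentre, and_comm, centralQuadric,
    mem_ofPred_eq]
  refine and_congr_right fun _ => ?_
  simp only [lor_sub_left, lor_sub_right, lor_smul_left, lor_smul_right, lor_comm x A]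
  field_simp
  exact ⟨fun h => by linear_combination m * h,
    fun h => mul_left_cancel₀ hm (by linear_combination h)⟩

theorem locus_umbilicalQuadric_eq_hyperplane_or_centralQuadric (hAm : A ≠ 0 ∨ m ≠ 0) (c : ℝ) :
    (∃ n ≠ 0, ∃ d, (umbilicalQuadric A m c).locus = hyperplane n d) ∨
      ∃ a ρ, (umbilicalQuadric A m c).locus = centralQuadric a ρ := by
  by_cases hm : m = 0
  · subst hm
    have hA := hAm.resolve_right (not_not.2 rfl)
    exact Or.inl ⟨A, hA, _, locus_umbilicalQuadric_zero hA c⟩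
  · exact Or.inr ⟨_, _, locus_umbilicalQuadric hm A c⟩

theorem IsNormalVector.hasFDerivAt_eval_umbilicalQuadric {E : Type*} [NormedAddCommGroup E]
    [NormedSpace ℝ E] {f : E → L4} {x : E} (hn : IsNormalVector f x (A - m • f x))
    (hf : DifferentiableAt ℝ f x) (c : ℝ) :
    HasFDerivAt (fun y => (umbilicalQuadric A m c).eval (f y)) (0 : E →L[ℝ] ℝ) x := by
  have heval : (fun y => (umbilicalQuadric A m c).eval (f y)) =
      fun y => c - lor ((2 : ℝ) • A - m • f y) (f y) := by
    ext y
    simp only [eval_umbilicalQuadric, lor_sub_left, lor_smul_left]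
    ring
  have hsub : DifferentiableAt ℝ (fun y => (2 : ℝ) • A - m • f y) x := by fun_prop
  have hzero : fderiv ℝ (fun y => c - lor ((2 : ℝ) • A - m • f y) (f y)) x = 0 := by
    ext v
    have hv := hn v
    rw [fderiv_const_sub, neg_apply, fderiv_lor_apply hsub hf, fderiv_const_sub,
      fderiv_fun_const_smul hf, neg_apply, smul_apply, zero_apply]
    simp only [lor_sub_left, lor_smul_left, lor_neg_left, lor_comm (fderiv ℝ f x v) (f x)] at hv ⊢
    linear_combination -2 * hv
  rw [heval, ← hzero]
  exact ((differentiableAt_lor hsub hf).const_sub c).hasFDerivAt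

end UmbilicalQuadrics

section SurfacesInQuadrics

variable {S : Type*} [TopologicalSpace S] [ChartedSpace Plane S] [IsManifold (𝓡 2) ∞ S]
  {ψ : S → L4} {A : L4} {m : ℝ}

namespace IsSpacelike

theorem exists_isOrthonormalPair_diff (hψ : IsSpacelike ψ) (y : S) :
    ∃ u₁ u₂, IsOrthonormalPair (diff ψ y u₁) (diff ψ y u₂) := by
  have hy := mem_chart_source Plane y
  obtain ⟨X, Y, hf⟩ := hψ.exists_isFramedSurface_inChart y
  obtain ⟨u₁, -, hu₁⟩ := hψ.exists_diff_eq_dirDeriv hy X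
  obtain ⟨u₂, -, hu₂⟩ := hψ.exists_diff_eq_dirDeriv hy Y
  exact ⟨u₁, u₂, hu₁ ▸ hu₂ ▸ hf.orthonormal _ (mem_chart_target Plane y)⟩

variable (hψ : IsSpacelike ψ) (hn : ∀ y, IsNormalAt ψ y (A - m • ψ y))
include hψ hn

theorem exists_eval_umbilicalQuadric_eq_zero [PreconnectedSpace S] :
    ∃ c, ∀ y, (umbilicalQuadric A m c).eval (ψ y) = 0 := by
  rcases isEmpty_or_nonempty S with _ | ⟨⟨p⟩⟩
  · exact ⟨0, fun y => isEmptyElim y⟩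
  refine ⟨-(umbilicalQuadric A m 0).eval (ψ p), fun y => ?_⟩
  have hyp := apply_eq_of_hasFDerivAt_inChart_zero
    (F := fun y => (umbilicalQuadric A m 0).eval (ψ y)) (fun p x hx => ?_) y p
  · rw [eval_umbilicalQuadric] at hyp ⊢
    linear_combination hyp
  · have hnx := (hψ.isNormalAt_iff ((chartAt Plane p).map_target hx)).1 (hn _)
    rw [(chartAt Plane p).right_inv hx] at hnx
    exact hnx.hasFDerivAt_eval_umbilicalQuadric (differentiableAt_of_contDiffOn
      (hψ.contDiffOn_inChart p) (chartAt Plane p).open_target hx) 0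

variable (hpar : HasParallelMeanCurv ψ)
include hpar

theorem sub_smul_ne_zero (hAm : A ≠ 0 ∨ m ≠ 0) (y : S) : A - m • ψ y ≠ 0 := by
  intro h₀
  have hm := hψ.lor_sub_smul_meanCurv_eq hpar hn y
  rw [h₀, lor_zero_left] at hm
  subst hm
  rw [zero_smul, sub_zero] at h₀
  exact hAm.elim (· h₀) (· rfl)

theorem hasConstantMeanCurvIn_umbilicalQuadric [PreconnectedSpace S] (hAm : A ≠ 0 ∨ m ≠ 0)
    {c : ℝ} (hc : ∀ y, (umbilicalQuadric A m c).eval (ψ y) = 0) :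
    HasConstantMeanCurvIn ψ (umbilicalQuadric A m c) := by
  rcases isEmpty_or_nonempty S with _ | ⟨⟨p⟩⟩
  · exact ⟨0, fun y => isEmptyElim y⟩
  refine ⟨√|lor (meanCurv ψ p) (meanCurv ψ p) - m ^ 2 / (lor A A - m * c)|, fun y ν hν => ?_⟩
  obtain ⟨u₁, u₂, hab⟩ := hψ.exists_isOrthonormalPair_diff y
  have hH := hψ.isNormalAt_meanCurv y
  have hnν : lor (A - m • ψ y) ν = 0 := by
    simpa [deriv_umbilicalQuadric] using hν.tangent
  have hnn : lor (A - m • ψ y) (A - m • ψ y) = lor A A - m * c := by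
    have hy := hc y
    rw [eval_umbilicalQuadric] at hy
    simp only [lor_sub_left, lor_sub_right, lor_smul_left, lor_smul_right, lor_comm (ψ y) A]
    linear_combination m * hy
  rw [hab.abs_lor_eq_sqrt (hn y u₁) (hn y u₂) (hν.normal u₁) (hν.normal u₂) (hH u₁) (hH u₂)
    (hψ.sub_smul_ne_zero hn hpar hAm y) hnν hν.unit, hψ.lor_sub_smul_meanCurv_eq hpar hn, hnn,
    hψ.lor_meanCurv_self_eq hpar y p]

end IsSpacelike

end SurfacesInQuadrics

end Minkowski

theorem mainTheorem4 {S : Type*} [TopologicalSpace S] [ChartedSpace Minkowski.Plane S]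
    [IsManifold (𝓡 2) ∞ S] [ConnectedSpace S]
    (ψ : S → Minkowski.L4) (hψ : Minkowski.IsSpacelike ψ)
    (hpar : Minkowski.HasParallelMeanCurv ψ) (hmax : ¬ Minkowski.IsMaximal ψ) :
    ∃ Q : Minkowski.Hyperquadric,
      Q.IsTotallyUmbilical ∧
      ((∃ n : Minkowski.L4, n ≠ 0 ∧ ∃ c : ℝ, Q.locus = Minkowski.hyperplane n c) ∨
        ∃ (a : Minkowski.L4) (ρ : ℝ), Q.locus = Minkowski.centralQuadric a ρ) ∧
      (∀ x : S, ψ x ∈ Q.locus) ∧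
      Minkowski.HasConstantMeanCurvIn ψ Q := by
  obtain ⟨A, m, hAm, hn⟩ := hψ.exists_forall_isNormalAt hpar hmax
  obtain ⟨c, hc⟩ := hψ.exists_eval_umbilicalQuadric_eq_zero hn
  refine ⟨Minkowski.umbilicalQuadric A m c, Minkowski.isTotallyUmbilical_umbilicalQuadric A m c,
    Minkowski.locus_umbilicalQuadric_eq_hyperplane_or_centralQuadric hAm c, fun x => ?_,
    hψ.hasConstantMeanCurvIn_umbilicalQuadric hn hpar hAm hc⟩
  exact Minkowski.mem_locus_umbilicalQuadric.2 ⟨hc x, hψ.sub_smul_ne_zero hn hpar hAm x⟩
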